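/- Let $d\ge 2$ and let $M$ be a closed (compact, without boundary), connected, Hausdorff $C^\infty$ manifold of dimension $d$. Let $d'\ge 0$ be an integer and $s$ a real number such that either $d'<d-1$ and $s\in[0,1]$, or $d'=d-1$ and $s\in[0,1)$. Here a function on a manifold is of class $C^{d',s}$ if in local coordinates it is of class $C^{d'}$ and its derivatives of order $d'$ are locally Hölder continuous with exponent $s$ (for $s=0$ this means $C^{d'}$). Then there exist a $C^\infty$ Riemannian metric $g$ on $M$, a function $f:M\to\mathbb R$ of class $C^{d',s}$ and of class $C^1$, and a compact connected set $\Lambda_0\subseteq M$ such that $df(q)=0$ for every $q\in\Lambda_0$ while $f$ is not constant on $\Lambda_0$, and such that the Hamiltonian $$H(q,p)=f(q)+\tfrac12|p|^2,\qquad (q,p)\in T^*M,$$ with $|\cdot|$ the norm on covectors induced by $g$, and the set $\Lambda=\{(q,0):q\in\Lambda_0\}$ have the following properties: 1. $H$ is of class $C^{d',s}$ and of class $C^1$ on $T^*M$. 2. $\Lambda$ is compact and connected and is contained in the zero section of $T^*M$, which is a Lagrangian graph (the graph of a one-form that is locally the differential of a $C^2$ function). 3. $\Lambda$ is invariant under the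 Hamiltonian dynamics of $H$: through every point of $\Lambda$ there passes an integral curve $\mathbb R\to T^*M$ of the Hamiltonian vector field $X_H$ that stays in $\Lambda$. If $d\ge 3$, then moreover every integral curve of $X_H$, on any open time interval, that meets $\Lambda$ stays in $\Lambda$. 4. $H$ is not constant on $\Lambda$. -/

import Mathlib

open Set Filter Topology Bundle
open scoped Manifold ContDiff NNReal

noncomputable section

namespace LagrangianGraphs

/-- The model space `ℝ^d`. -/
abbrev Model (d : ℕ) : Type := EuclideanSpace ℝ (Fin d)

/-- The model space `(ℝ^d)^*` of the cotangent fibres. -/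
abbrev CoModel (d : ℕ) : Type := EuclideanSpace ℝ (Fin d) →L[ℝ] ℝ

/-- The cotangent space `T_q^*M`. -/
abbrev CotangentSpace (d : ℕ) {M : Type*} [TopologicalSpace M] [ChartedSpace (Model d) M]
    (q : M) : Type :=
  TangentSpace (𝓡 d) q →L[ℝ] ℝ

/-- The cotangent bundle `T^*M`, with the topology and the manifold structure of the bundle of
continuous linear maps from the tangent bundle to the trivial line bundle. Its points are pairs
`⟨q, p⟩` with `p ∈ T_q^*M`. -/
abbrev CotangentBundle (d : ℕ) (M : Type*) [TopologicalSpace M] [ChartedSpace (Model d) M]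
    [IsManifold (𝓡 d) ∞ M] : Type _ :=
  TotalSpace (CoModel d) (fun q : M => TangentSpace (𝓡 d) q →L[ℝ] ℝ)

/-- The model with corners of `T^*M`, on `ℝ^d × (ℝ^d)^*`. -/
abbrev cotangentModel (d : ℕ) :
    ModelWithCorners ℝ (Model d × CoModel d) (ModelProd (Model d) (CoModel d)) :=
  (𝓡 d).prod 𝓘(ℝ, CoModel d)

/-- `f ∈ C^{k,s}(N, ℝ)` on a manifold `N` without boundary: in local coordinates `f` is of class
`C^k` and its derivative of order `k` is locally Hölder continuous with exponent `s`
(for `s = 0` this is `C^k`, for `s = 1` the `k`-th derivative is locally Lipschitz). -/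
def IsCkHolder {E H N : Type*} [NormedAddCommGroup E] [NormedSpace ℝ E] [TopologicalSpace H]
    (I : ModelWithCorners ℝ E H) [TopologicalSpace N] [ChartedSpace H N]
    (k : ℕ) (s : ℝ≥0) (f : N → ℝ) : Prop :=
  ∀ x : N, ∃ U ∈ 𝓝 (extChartAt I x x),
    ContDiffOn ℝ k (f ∘ (extChartAt I x).symm) U ∧
    ∃ C : ℝ≥0, HolderOnWith C s (iteratedFDeriv ℝ k (f ∘ (extChartAt I x).symm)) U

/-- A positive definite bilinear form on a finite-dimensional space is invertible as a map to the
dual space. -/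
theorem apply_inverse_of_pos {V : Type*} [NormedAddCommGroup V] [NormedSpace ℝ V]
    [FiniteDimensional ℝ V] (B : V →L[ℝ] V →L[ℝ] ℝ) (hB : ∀ v, v ≠ 0 → 0 < B v v)
    (p : V →L[ℝ] ℝ) : B (ContinuousLinearMap.inverse B p) = p := by
  have hinj : Function.Injective (B : V →ₗ[ℝ] V →L[ℝ] ℝ) := by
    rw [← LinearMap.ker_eq_bot, LinearMap.ker_eq_bot']
    intro v hv
    by_contra hne
    have h := hB v hne
    have h0 : B v = 0 := hv
    simp [h0] at h
  have hdim : Module.finrank ℝ V = Module.finrank ℝ (V →L[ℝ] ℝ) :=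
    (Subspace.dual_finrank_eq (K := ℝ) (V := V)).symm.trans
      (LinearMap.toContinuousLinearMap (𝕜 := ℝ) (E := V) (F' := ℝ)).finrank_eq
  let e : V ≃L[ℝ] (V →L[ℝ] ℝ) :=
    (LinearEquiv.ofInjectiveOfFinrankEq _ hinj hdim).toContinuousLinearEquiv
  have he : (e : V →L[ℝ] V →L[ℝ] ℝ) = B := by
    ext v w
    rfl
  rw [← he, ContinuousLinearMap.inverse_equiv]
  exact e.apply_symm_apply p

section

variable {d : ℕ} {M : Type*} [TopologicalSpace M] [ChartedSpace (Model d) M]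
  [IsManifold (𝓡 d) ∞ M]

/-- A `C^∞` Riemannian metric on `M`. -/
abbrev SmoothMetric (d : ℕ) (M : Type*) [TopologicalSpace M] [ChartedSpace (Model d) M]
    [IsManifold (𝓡 d) ∞ M] : Type _ :=
  ContMDiffRiemannianMetric (𝓡 d) ∞ (Model d) (fun q : M => TangentSpace (𝓡 d) q)

/-- The musical isomorphism `p ↦ p^♯`, the inverse of `v ↦ g_q(v, ·)`. -/
def sharp (g : SmoothMetric d M) (q : M) (p : CotangentSpace d q) : TangentSpace (𝓡 d) q :=
  ContinuousLinearMap.inverse (g.inner q) p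

/-- `p^♯` is the vector that represents `p`. -/
theorem inner_sharp (g : SmoothMetric d M) (q : M) (p : CotangentSpace d q) :
    g.inner q (sharp g q p) = p :=
  apply_inverse_of_pos (V := Model d) (g.inner q) (g.pos q) p

/-- The square `|p|²` of the norm of a covector, `|p|² = p(p^♯) = g(p^♯, p^♯)`. -/
def conormSq (g : SmoothMetric d M) (q : M) (p : CotangentSpace d q) : ℝ :=
  p (sharp g q p)

/-- The Hamiltonian `H(q, p) = f(q) + |p|²/2`. -/
def mechanicalHamiltonian (g : SmoothMetric d M) (f : M → ℝ) (x : CotangentBundle d M) : ℝ :=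
  f x.proj + conormSq g x.proj x.snd / 2

/-- The Hamiltonian vector field `X_H` on `T^*M`, given by Hamilton's equations
`dq_i/dt = ∂H/∂p_i`, `dp_i/dt = -∂H/∂q_i`. The tangent space of `T^*M` at `x` is `ℝ^d × (ℝ^d)^*`,
read in the canonical coordinates `(q, p)` that the preferred chart of `M` at the base point of `x`
induces on `T^*M`. -/
def hamiltonianVectorField (H : CotangentBundle d M → ℝ) (x : CotangentBundle d M) :
    TangentSpace (cotangentModel d) x :=
  let dH : Model d × CoModel d →L[ℝ] ℝ := mfderiv (cotangentModel d) 𝓘(ℝ, ℝ) H x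
  ((WithLp.toLp 2 fun i : Fin d => dH (0, EuclideanSpace.proj i),
    -(dH.comp (ContinuousLinearMap.inl ℝ (Model d) (CoModel d)))) : Model d × CoModel d)

/-- Invariance of `Λ` under the Hamiltonian dynamics of `H`: each point of `Λ` lies on an
orbit, defined for all times, that stays in `Λ`. When `X_H` generates a flow this is invariance
under the flow; it makes sense also for an `X_H` that is only continuous. -/
def IsInvariant (H : CotangentBundle d M → ℝ) (Λ : Set (CotangentBundle d M)) : Prop :=
  ∀ x ∈ Λ, ∃ γ : ℝ → CotangentBundle d M,
    γ 0 = x ∧ IsMIntegralCurve (I := cotangentModel d) γ (hamiltonianVectorField H) ∧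
      ∀ t, γ t ∈ Λ

/-- Every orbit of `X_H`, on whatever open time interval, that meets `Λ` stays in `Λ`. -/
def ContainsItsOrbits (H : CotangentBundle d M → ℝ) (Λ : Set (CotangentBundle d M)) : Prop :=
  ∀ (γ : ℝ → CotangentBundle d M) (a b : ℝ),
    IsMIntegralCurveOn (I := cotangentModel d) γ (hamiltonianVectorField H) (Ioo a b) →
    ∀ t₀ ∈ Ioo a b, γ t₀ ∈ Λ → ∀ t ∈ Ioo a b, γ t ∈ Λ

/-- The graph `{(q, Γ(q))}` of a one-form `Γ`, as a subset of `T^*M`. -/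
def graph (Γ : (q : M) → CotangentSpace d q) : Set (CotangentBundle d M) :=
  {x | x.snd = Γ x.proj}

/-- The graph of the one-form `Γ` is a (`C^1`) Lagrangian graph: locally, `Γ` is the
differential of a function of class `C^2`. -/
def IsLagrangianGraph (Γ : (q : M) → CotangentSpace d q) : Prop :=
  ∀ q : M, ∃ U : Set M, IsOpen U ∧ q ∈ U ∧ ∃ u : M → ℝ,
    ContMDiffOn (𝓡 d) 𝓘(ℝ, ℝ) 2 u U ∧ ∀ x ∈ U, Γ x = mfderiv (𝓡 d) 𝓘(ℝ, ℝ) u x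

/-- A Whitney–Norton pair: `f` is `C^1`, `Λ₀` is a compact connected set of critical points
of `f`, and `f` is not constant on `Λ₀`. -/
structure IsWhitneyNorton (d : ℕ) {M : Type*} [TopologicalSpace M] [ChartedSpace (Model d) M]
    (f : M → ℝ) (Λ₀ : Set M) : Prop where
  contMDiff : ContMDiff (𝓡 d) 𝓘(ℝ, ℝ) 1 f
  isCompact : IsCompact Λ₀
  isConnected : IsConnected Λ₀
  critical : ∀ q ∈ Λ₀, mfderiv (𝓡 d) 𝓘(ℝ, ℝ) f q = 0
  not_constant : ∃ q₁ ∈ Λ₀, ∃ q₂ ∈ Λ₀, f q₁ ≠ f q₂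

end

end LagrangianGraphs

end

/-!
The function is a self-similar version of Whitney's example. Two similarities of `ℝ^d`, each
permuting the axes cyclically and contracting by a ratio `μ` slightly smaller than `2^{-1/d}`, map
a box into itself with disjoint images, and on each image the function is a copy of itself halved
and shifted by `±1/2`. It is therefore a sum of corrections of height `2^{-n}` at scale `μ^n`, which
is of class `C^{k,s}` as soon as `μ^{-(k+s)} < 2`; for `μ` close to `2^{-1/d}` this allows every
`k + s < d`. Joining the two copies, at each stage, by sets along which the function is locally
constant produces a compact connected set. In the images of level `n` the differential is at most
`(2μ)^{-n}` times its maximum over the box, so that it vanishes on the connected set, although the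
function is not constant there.

A chart onto `ℝ^d` transplants the function to `M`. The points of the zero section over the critical
set are equilibria of the mechanical system. When `d ≥ 3` the potential is `C²`: by conservation of
energy the speed of a motion through an equilibrium is bounded by a multiple of its distance to the
equilibrium, and Grönwall's inequality forces the motion to be constant.
-/

noncomputable section

namespace LagrangianGraphs

section CkHolder

universe u

variable {E E' G G' G'' : Type u} [NormedAddCommGroup E] [NormedSpace ℝ E]
  [NormedAddCommGroup E'] [NormedSpace ℝ E'] [NormedAddCommGroup G] [NormedSpace ℝ G]
  [NormedAddCommGroup G'] [NormedSpace ℝ G'] [NormedAddCommGroup G''] [NormedSpace ℝ G'']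
  {k : ℕ} {s : ℝ≥0} {x : E}

/-- `f` is of class `C^{k,s}` on a neighbourhood of `x`. All spaces live in one universe, because
inductions on `k` replace the codomain `G` by `E →L[ℝ] G`. -/
def CkHolderAt (k : ℕ) (s : ℝ≥0) (f : E → G) (x : E) : Prop :=
  ∃ U ∈ 𝓝 x, ContDiffOn ℝ k f U ∧ ∃ C : ℝ≥0, HolderOnWith C s (iteratedFDeriv ℝ k f) U

theorem CkHolderAt.contDiffAt {f : E → G} (hf : CkHolderAt k s f x) : ContDiffAt ℝ k f x := by
  obtain ⟨U, hU, hc, -⟩ := hf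
  exact hc.contDiffAt hU

theorem CkHolderAt.congr {f g : E → G} (hf : CkHolderAt k s f x) (h : g =ᶠ[𝓝 x] f) :
    CkHolderAt k s g x := by
  obtain ⟨U, hU, hc, C, hC⟩ := hf
  obtain ⟨V, hV, hVo, hxV⟩ := eventually_nhds_iff.1 h
  refine ⟨U ∩ V, inter_mem hU (hVo.mem_nhds hxV), (hc.mono inter_subset_left).congr
    fun y hy => hV y hy.2, C, fun y hy z hz => ?_⟩
  have key : ∀ y ∈ V, iteratedFDeriv ℝ k g y = iteratedFDeriv ℝ k f y := fun y hy =>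
    (EventuallyEq.iteratedFDeriv ℝ (eventually_nhds_iff.2 ⟨V, hV, hVo, hy⟩) k).eq_of_nhds
  rw [key y hy.2, key z hz.2]
  exact hC y hy.1 z hz.1

theorem CkHolderAt.add {f g : E → G} (hf : CkHolderAt k s f x) (hg : CkHolderAt k s g x) :
    CkHolderAt k s (fun y => f y + g y) x := by
  obtain ⟨U, hU, hc, C, hC⟩ := hf
  obtain ⟨V, hV, hc', C', hC'⟩ := hg
  have hUV : interior (U ∩ V) ⊆ U ∩ V := interior_subset
  have key : ∀ y ∈ interior (U ∩ V), iteratedFDeriv ℝ k (fun y => f y + g y) y =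
      iteratedFDeriv ℝ k f y + iteratedFDeriv ℝ k g y := fun y hy => by
    have h := mem_interior_iff_mem_nhds.1 hy
    exact fun_iteratedFDeriv_add_apply (hc.contDiffAt (mem_of_superset h inter_subset_left))
      (hc'.contDiffAt (mem_of_superset h inter_subset_right))
  refine ⟨interior (U ∩ V), interior_mem_nhds.2 (inter_mem hU hV),
    (hc.mono (hUV.trans inter_subset_left)).add (hc'.mono (hUV.trans inter_subset_right)),
    C + C', fun y hy z hz => ?_⟩
  rw [key y hy, key z hz, ENNReal.coe_add, add_mul]
  exact (edist_add_add_le _ _ _ _).trans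
    (add_le_add (hC y (hUV hy).1 z (hUV hz).1) (hC' y (hUV hy).2 z (hUV hz).2))

theorem exists_holderOnWith_of_contDiffAt {f : E → G} (hf : ContDiffAt ℝ 1 f x) (hs : s ≤ 1) :
    ∃ U ∈ 𝓝 x, ∃ C, HolderOnWith C s f U := by
  obtain ⟨K, U, hU, hK⟩ := hf.exists_lipschitzOnWith
  have hK' : HolderOnWith K 1 f (U ∩ Metric.ball x 1) :=
    (holderOnWith_one.2 hK).mono inter_subset_left
  refine ⟨U ∩ Metric.ball x 1, inter_mem hU (Metric.ball_mem_nhds x one_pos), _,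
    hK'.of_le (D := 2) (fun y hy z hz => ?_) hs⟩
  rw [edist_dist]
  refine ENNReal.ofReal_le_of_le_toReal ?_
  have := dist_triangle_right y z x
  have := Metric.mem_ball.1 hy.2
  have := Metric.mem_ball.1 hz.2
  norm_num
  linarith

theorem CkHolderAt.of_contDiffAt {f : E → G} (hs : s ≤ 1) (hf : ContDiffAt ℝ (k + 1 : ℕ) f x) :
    CkHolderAt k s f x := by
  obtain ⟨U, hU, hc⟩ := (hf.of_le (by exact_mod_cast k.le_succ) :
    ContDiffAt ℝ k f x).contDiffOn le_rfl (by simp)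
  obtain ⟨V, hV, C, hC⟩ := exists_holderOnWith_of_contDiffAt
    (hf.iteratedFDeriv_right (m := 1) (i := k) (by push_cast; rw [add_comm])) hs
  exact ⟨U ∩ V, inter_mem (by simpa using hU) hV, hc.mono inter_subset_left, C,
    hC.mono inter_subset_right⟩

theorem ckHolderAt_zero_iff {f : E → G} :
    CkHolderAt 0 s f x ↔ ∃ U ∈ 𝓝 x, ContinuousOn f U ∧ ∃ C, HolderOnWith C s f U := by
  simp only [CkHolderAt, Nat.cast_zero, contDiffOn_zero, HolderOnWith, iteratedFDeriv_zero_eq_comp,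
    Function.comp_apply, LinearIsometryEquiv.edist_map]

theorem ckHolderAt_succ_iff {f : E → G} :
    CkHolderAt (k + 1) s f x ↔
      (∀ᶠ y in 𝓝 x, DifferentiableAt ℝ f y) ∧ CkHolderAt k s (fderiv ℝ f) x := by
  have hsucc (U : Set E) (C : ℝ≥0) : HolderOnWith C s (iteratedFDeriv ℝ (k + 1) f) U ↔
      HolderOnWith C s (iteratedFDeriv ℝ k (fderiv ℝ f)) U := by
    simp only [HolderOnWith, iteratedFDeriv_succ_eq_comp_right, Function.comp_apply,
      LinearIsometryEquiv.edist_map]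
  simp only [CkHolderAt, hsucc]
  constructor
  · rintro ⟨U, hU, hc, C, hC⟩
    rw [← interior_mem_nhds] at hU
    obtain ⟨hd, -, hc'⟩ := (contDiffOn_succ_iff_fderiv_of_isOpen isOpen_interior).1
      (by exact_mod_cast hc.mono interior_subset :
        ContDiffOn ℝ ((k : WithTop ℕ∞) + 1) f (interior U))
    refine ⟨?_, interior U, hU, hc', C, hC.mono interior_subset⟩
    filter_upwards [isOpen_interior.mem_nhds (mem_of_mem_nhds hU)] with y hy
    exact (hd y hy).differentiableAt (isOpen_interior.mem_nhds hy)
  · rintro ⟨hd, U, hU, hc, C, hC⟩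
    obtain ⟨V, hV, hVo, hxV⟩ := mem_nhds_iff.1 (inter_mem hU hd)
    refine ⟨V, hVo.mem_nhds hxV, ?_, C, hC.mono fun y hy => (hV hy).1⟩
    have := (contDiffOn_succ_iff_fderiv_of_isOpen (n := k) hVo).2
      ⟨fun y hy => (hV hy).2.differentiableWithinAt, by simp,
        hc.mono fun y hy => (hV hy).1⟩
    exact_mod_cast this

theorem ckHolderAt_zero_bilinear (B : G →L[ℝ] G' →L[ℝ] G'') {f : E → G} {g : E → G'}
    (hf : CkHolderAt 0 s f x) (hg : CkHolderAt 0 s g x) :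
    CkHolderAt 0 s (fun y => B (f y) (g y)) x := by
  obtain ⟨U, hU, hfc, C, hC⟩ := ckHolderAt_zero_iff.1 hf
  obtain ⟨V, hV, hgc, D, hD⟩ := ckHolderAt_zero_iff.1 hg
  obtain ⟨W, hW, hWb⟩ : ∃ W ∈ 𝓝 x, ∀ y ∈ W, ‖f y‖₊ ≤ ‖f x‖₊ + 1 ∧ ‖g y‖₊ ≤ ‖g x‖₊ + 1 :=
    ⟨_, ((hfc.continuousAt hU).nnnorm.eventually_le_const (lt_add_one _)).and
      ((hgc.continuousAt hV).nnnorm.eventually_le_const (lt_add_one _)), fun _ => id⟩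
  refine ckHolderAt_zero_iff.2 ⟨U ∩ V ∩ W, inter_mem (inter_mem hU hV) hW, ?_,
    ‖B‖₊ * (‖g x‖₊ + 1) * C + ‖B‖₊ * (‖f x‖₊ + 1) * D, fun y hy z hz => ?_⟩
  · exact B.isBoundedBilinearMap.continuous.comp_continuousOn
      ((hfc.mono fun y hy => hy.1.1).prodMk (hgc.mono fun y hy => hy.1.2))
  · have hBg : ‖B.flip (g y)‖₊ ≤ ‖B‖₊ * (‖g x‖₊ + 1) :=
      (B.flip.le_opNNNorm (g y)).trans
        (mul_le_mul' B.opNNNorm_flip.le (hWb y hy.2).2)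
    have hBf : ‖B (f z)‖₊ ≤ ‖B‖₊ * (‖f x‖₊ + 1) :=
      (B.le_opNNNorm (f z)).trans (mul_le_mul_right (hWb z hz.2).1 _)
    have hleft : edist (B (f y) (g y)) (B (f z) (g y)) ≤
        (‖B‖₊ * (‖g x‖₊ + 1) * C : ℝ≥0) * edist y z ^ (s : ℝ) := by
      rw [ENNReal.coe_mul, mul_assoc]
      exact ((B.flip (g y)).lipschitz (f y) (f z)).trans
        (mul_le_mul' (ENNReal.coe_le_coe.2 hBg) (hC y hy.1.1 z hz.1.1))
    have hright : edist (B (f z) (g y)) (B (f z) (g z)) ≤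
        (‖B‖₊ * (‖f x‖₊ + 1) * D : ℝ≥0) * edist y z ^ (s : ℝ) := by
      rw [ENNReal.coe_mul, mul_assoc]
      exact ((B (f z)).lipschitz (g y) (g z)).trans
        (mul_le_mul' (ENNReal.coe_le_coe.2 hBf) (hD y hy.1.2 z hz.1.2))
    rw [ENNReal.coe_add, add_mul]
    exact (edist_triangle _ _ _).trans (add_le_add hleft hright)

theorem CkHolderAt.bilinear (hs : s ≤ 1) (B : G →L[ℝ] G' →L[ℝ] G'') {f : E → G} {g : E → G'}
    (hf : CkHolderAt k s f x) (hg : CkHolderAt k s g x) :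
    CkHolderAt k s (fun y => B (f y) (g y)) x := by
  induction k generalizing G G' G'' with
  | zero => exact ckHolderAt_zero_bilinear B hf hg
  | succ k ih =>
    obtain ⟨hfd, hf'⟩ := ckHolderAt_succ_iff.1 hf
    obtain ⟨hgd, hg'⟩ := ckHolderAt_succ_iff.1 hg
    have hderiv : ∀ᶠ y in 𝓝 x, HasFDerivAt (fun y => B (f y) (g y))
        (B.precompR E (f y) (fderiv ℝ g y) + B.precompL E (fderiv ℝ f y) (g y)) y := by
      filter_upwards [hfd, hgd] with y hfy hgy
      exact B.hasFDerivAt_of_bilinear hfy.hasFDerivAt hgy.hasFDerivAt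
    refine ckHolderAt_succ_iff.2 ⟨hderiv.mono fun y hy => hy.differentiableAt, ?_⟩
    exact ((ih (B.precompR E) (.of_contDiffAt hs hf.contDiffAt) hg').add
      (ih (B.precompL E) hf' (.of_contDiffAt hs hg.contDiffAt))).congr
      (hderiv.mono fun y hy => hy.fderiv)

theorem CkHolderAt.comp_contDiffAt (hs : s ≤ 1) {f : E → G} {h : E' → E} {x : E'}
    (hf : CkHolderAt k s f (h x)) (hh : ContDiffAt ℝ (k + 1 : ℕ) h x) :
    CkHolderAt k s (f ∘ h) x := by
  induction k generalizing G with
  | zero =>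
    obtain ⟨U, hU, hc, C, hC⟩ := ckHolderAt_zero_iff.1 hf
    obtain ⟨K, V, hV, hK⟩ :=
      (hh.of_le (by norm_num) : ContDiffAt ℝ 1 h x).exists_lipschitzOnWith
    have hUV : MapsTo h (h ⁻¹' U ∩ V) U := fun y hy => hy.1
    exact ckHolderAt_zero_iff.2 ⟨h ⁻¹' U ∩ V, inter_mem (hh.continuousAt hU) hV,
      hc.comp (hK.continuousOn.mono inter_subset_right) hUV, _, by
        simpa only [mul_one] using
          hC.comp (holderOnWith_one.2 (hK.mono inter_subset_right)) hUV⟩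
  | succ k ih =>
    obtain ⟨hfd, hf'⟩ := ckHolderAt_succ_iff.1 hf
    have hderiv : ∀ᶠ y in 𝓝 x, HasFDerivAt (f ∘ h)
        (ContinuousLinearMap.compL ℝ E' E G (fderiv ℝ f (h y)) (fderiv ℝ h y)) y := by
      filter_upwards [hh.continuousAt.eventually hfd, hh.eventually (by simp)] with y hfy hhy
      exact hfy.hasFDerivAt.comp y (hhy.differentiableAt (by simp)).hasFDerivAt
    refine ckHolderAt_succ_iff.2 ⟨hderiv.mono fun y hy => hy.differentiableAt, ?_⟩
    exact ((ih hf' (hh.of_le (by exact_mod_cast (k + 1).le_succ))).bilinear hs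
      (ContinuousLinearMap.compL ℝ E' E G)
      (.of_contDiffAt hs (hh.fderiv_right (by norm_cast)))).congr
      (hderiv.mono fun y hy => hy.fderiv)

end CkHolder

section ScaleSequence

theorem min_one_le_rpow {t s : ℝ} (ht : 0 ≤ t) (hs₀ : 0 ≤ s) (hs₁ : s ≤ 1) :
    min 1 t ≤ t ^ s := by
  rcases le_total 1 t with h | h
  · exact (min_le_left _ _).trans (Real.one_le_rpow h hs₀)
  · calc min 1 t ≤ t ^ (1 : ℝ) := (min_le_right _ _).trans (Real.rpow_one t).ge
      _ ≤ t ^ s := Real.rpow_le_rpow_of_exponent_ge' ht h hs₀ hs₁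

theorem holderOnWith_of_dist_le {X Y : Type*} [PseudoMetricSpace X] [PseudoMetricSpace Y]
    {f : X → Y} {U : Set X} {C s : ℝ≥0}
    (h : ∀ x ∈ U, ∀ y ∈ U, dist (f x) (f y) ≤ C * dist x y ^ (s : ℝ)) : HolderOnWith C s f U := by
  intro x hx y hy
  rw [edist_dist, edist_dist, ENNReal.ofReal_rpow_of_nonneg (p := (s : ℝ)) dist_nonneg s.coe_nonneg,
    ← ENNReal.ofReal_coe_nnreal, ← ENNReal.ofReal_mul C.coe_nonneg]
  exact ENNReal.ofReal_le_ofReal (h x hx y hy)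

universe u

variable {E G : Type u} [NormedAddCommGroup E] [NormedSpace ℝ E] [NormedAddCommGroup G]
  [NormedSpace ℝ G]

/-- The `u n` are smooth functions that oscillate at most at the scale `L⁻ⁿ`, with amplitudes of
order `qⁿ`. For instance `u n = qⁿ • u 0 (Lⁿ • ·)`, with bounded derivatives of `u 0`. -/
structure IsScaleSequence (L q : ℝ) (u : ℕ → E → G) : Prop where
  contDiff : ∀ n, ContDiff ℝ ∞ (u n)
  exists_bound : ∀ i, ∃ A, ∀ n x, ‖iteratedFDeriv ℝ i (u n) x‖ ≤ A * (L ^ i * q) ^ n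

namespace IsScaleSequence

variable {L q : ℝ} {u : ℕ → E → G} {k : ℕ} {s : ℝ≥0}

theorem summable_bound (hL : 1 ≤ L) (hq : 0 ≤ q) (hk : L ^ k * q < 1) (A : ℝ) {i : ℕ}
    (hi : i ≤ k) : Summable fun n => A * (L ^ i * q) ^ n := by
  refine (summable_geometric_of_lt_one (by positivity) (lt_of_le_of_lt ?_ hk)).mul_left A
  gcongr

theorem exists_norm_iteratedFDeriv_sub_le (hu : IsScaleSequence L q u) (hL : 0 < L) (hq : 0 ≤ q)
    (hs : s ≤ 1) (k : ℕ) :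
    ∃ A, ∀ n x y, ‖iteratedFDeriv ℝ k (u n) x - iteratedFDeriv ℝ k (u n) y‖ ≤
      A * dist x y ^ (s : ℝ) * (L ^ (k + s : ℝ) * q) ^ n := by
  obtain ⟨A₀, hA₀⟩ := hu.exists_bound k
  obtain ⟨A₁, hA₁⟩ := hu.exists_bound (k + 1)
  refine ⟨max (2 * A₀) A₁, fun n x y => ?_⟩
  have hsup : ‖iteratedFDeriv ℝ k (u n) x - iteratedFDeriv ℝ k (u n) y‖ ≤
      2 * A₀ * (L ^ k * q) ^ n := by
    linarith [norm_sub_le (iteratedFDeriv ℝ k (u n) x) (iteratedFDeriv ℝ k (u n) y),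
      hA₀ n x, hA₀ n y]
  have hlip : ‖iteratedFDeriv ℝ k (u n) x - iteratedFDeriv ℝ k (u n) y‖ ≤
      A₁ * (L ^ (k + 1) * q) ^ n * dist x y := by
    rw [dist_eq_norm]
    refine convex_univ.norm_image_sub_le_of_norm_fderiv_le (𝕜 := ℝ) (fun z _ => ?_) (fun z _ => ?_)
      (mem_univ y) (mem_univ x)
    · exact (hu.contDiff n).differentiable_iteratedFDeriv (by exact_mod_cast WithTop.coe_lt_top _) z
    · exact norm_fderiv_iteratedFDeriv.trans_le (hA₁ n z)
  have hpow : (L ^ (k + s : ℝ) * q) ^ n = (L ^ k * q) ^ n * (L ^ n) ^ (s : ℝ) := by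
    rw [Real.rpow_add hL, Real.rpow_natCast, ← Real.rpow_pow_comm hL.le]
    ring
  have hA₀_nonneg : 0 ≤ A₀ := by simpa using (norm_nonneg _).trans (hA₀ 0 x)
  calc ‖iteratedFDeriv ℝ k (u n) x - iteratedFDeriv ℝ k (u n) y‖
      ≤ max (2 * A₀) A₁ * (L ^ k * q) ^ n * min 1 (L ^ n * dist x y) := by
        rw [mul_min_of_nonneg _ _ (by positivity), mul_one]
        refine le_min (hsup.trans ?_) (hlip.trans ?_)
        · gcongr
          exact le_max_left _ _
        · rw [show A₁ * (L ^ (k + 1) * q) ^ n * dist x y =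
            A₁ * (L ^ k * q) ^ n * (L ^ n * dist x y) by ring]
          gcongr
          exact le_max_right _ _
    _ ≤ max (2 * A₀) A₁ * (L ^ k * q) ^ n * (L ^ n * dist x y) ^ (s : ℝ) := by
        gcongr
        exact min_one_le_rpow (by positivity) s.coe_nonneg hs
    _ = max (2 * A₀) A₁ * dist x y ^ (s : ℝ) * (L ^ (k + s : ℝ) * q) ^ n := by
        rw [hpow, Real.mul_rpow (by positivity) dist_nonneg]
        ring

variable [CompleteSpace G]

theorem contDiff_tsum (hu : IsScaleSequence L q u) (hL : 1 ≤ L) (hq : 0 ≤ q)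
    (hk : L ^ k * q < 1) : ContDiff ℝ k (fun x => ∑' n, u n x) := by
  choose A hA using hu.exists_bound
  exact_mod_cast _root_.contDiff_tsum (𝕜 := ℝ) (N := (k : ℕ∞))
    (fun n => (hu.contDiff n).of_le (by exact_mod_cast le_top))
    (fun i hi => summable_bound hL hq hk (A i) (Nat.cast_le.1 hi)) (fun i n x _ => hA i n x)

theorem hasSum_iteratedFDeriv (hu : IsScaleSequence L q u) (hL : 1 ≤ L) (hq : 0 ≤ q)
    (hk : L ^ k * q < 1) (x : E) :
    HasSum (fun n => iteratedFDeriv ℝ k (u n) x)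
      (iteratedFDeriv ℝ k (fun x => ∑' n, u n x) x) := by
  choose A hA using hu.exists_bound
  rw [iteratedFDeriv_tsum_apply (𝕜 := ℝ) (N := (k : ℕ∞))
    (fun n => (hu.contDiff n).of_le (by exact_mod_cast le_top))
    (fun i hi => summable_bound hL hq hk (A i) (Nat.cast_le.1 hi)) (fun i n x _ => hA i n x)
    le_rfl x]
  exact (Summable.of_norm_bounded (summable_bound hL hq hk (A k) le_rfl) fun n =>
    hA k n x).hasSum

theorem ckHolderAt_tsum (hu : IsScaleSequence L q u) (hL : 1 ≤ L) (hq : 0 ≤ q) (hs : s ≤ 1)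
    (hks : L ^ (k + s : ℝ) * q < 1) (x : E) : CkHolderAt k s (fun x => ∑' n, u n x) x := by
  have hL₀ : 0 < L := one_pos.trans_le hL
  have hk : L ^ k * q < 1 := by
    refine lt_of_le_of_lt ?_ hks
    rw [← Real.rpow_natCast]
    gcongr
    exact le_add_of_nonneg_right s.coe_nonneg
  obtain ⟨A, hA⟩ := hu.exists_norm_iteratedFDeriv_sub_le hL₀ hq hs k
  refine ⟨univ, univ_mem, (hu.contDiff_tsum hL hq hk).contDiffOn,
    (A * ∑' n, (L ^ (k + s : ℝ) * q) ^ n).toNNReal,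
    holderOnWith_of_dist_le fun y _ z _ => ?_⟩
  have hgeom := summable_geometric_of_lt_one (by positivity) hks
  rw [dist_eq_norm, ← ((hu.hasSum_iteratedFDeriv hL hq hk y).sub
    (hu.hasSum_iteratedFDeriv hL hq hk z)).tsum_eq]
  calc _ ≤ A * dist y z ^ (s : ℝ) * ∑' n, (L ^ (k + s : ℝ) * q) ^ n :=
        tsum_of_norm_bounded (hgeom.hasSum.mul_left _) fun n => hA n y z
    _ = A * (∑' n, (L ^ (k + s : ℝ) * q) ^ n) * dist y z ^ (s : ℝ) := by ring
    _ ≤ _ := by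
        gcongr
        exact Real.le_coe_toNNReal _

end IsScaleSequence

end ScaleSequence

section SelfSimilar

universe u

/-- A family of similarities `x ↦ center i + ratio • rotation x`, `i : ι`, with a common linear
part. -/
structure SimilaritySystem (ι E : Type*) [NormedAddCommGroup E] [NormedSpace ℝ E] where
  ratio : ℝ
  ratio_pos : 0 < ratio
  rotation : E ≃ₗᵢ[ℝ] E
  center : ι → E

namespace SimilaritySystem

variable {ι : Type*} {E G : Type u} [NormedAddCommGroup E] [NormedSpace ℝ E]
  [NormedAddCommGroup G] [NormedSpace ℝ G]

/-- The `i`-th similarity of the system. -/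
@[simps]
def branch (S : SimilaritySystem ι E) (i : ι) : E ≃ E where
  toFun x := S.center i + S.ratio • S.rotation x
  invFun x := S.rotation.symm (S.ratio⁻¹ • (x - S.center i))
  left_inv x := by simp [smul_smul, S.ratio_pos.ne']
  right_inv x := by simp [smul_smul, S.ratio_pos.ne']

/-- The strong separation condition, realised in the closed set `C`: the similarities map `C` into
itself, onto pairwise disjoint sets. -/
structure Separates (S : SimilaritySystem ι E) (C : Set E) : Prop where
  isClosed : IsClosed C
  mapsTo : ∀ i, MapsTo (S.branch i) C C
  eq_of_mem : ∀ {i j x}, (S.branch i).symm x ∈ C → (S.branch j).symm x ∈ C → i = j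

/-- The operator `u ↦ q • ∑ i, u ∘ (S.branch i)⁻¹`, which places a copy of `u`, scaled by `q`, into
the image of each similarity. -/
def transfer [Fintype ι] (S : SimilaritySystem ι E) (q : ℝ) (u : E → G) (x : E) : G :=
  q • ∑ i, u ((S.branch i).symm x)

variable {S : SimilaritySystem ι E} {C : Set E} {q : ℝ} {u ψ : E → G} {x : E}

theorem contDiff_branch (S : SimilaritySystem ι E) (i : ι) {n : WithTop ℕ∞} :
    ContDiff ℝ n (S.branch i) :=
  contDiff_const.add (S.rotation.contDiff.const_smul _)

theorem contDiff_branch_symm (S : SimilaritySystem ι E) (i : ι) {n : WithTop ℕ∞} :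
    ContDiff ℝ n (S.branch i).symm :=
  S.rotation.symm.contDiff.comp ((contDiff_id.sub contDiff_const).const_smul _)

theorem norm_iteratedFDeriv_comp_branch_symm (S : SimilaritySystem ι E) (i : ι)
    (hu : ContDiff ℝ ∞ u) (k : ℕ) (x : E) :
    ‖iteratedFDeriv ℝ k (fun x => u ((S.branch i).symm x)) x‖ =
      S.ratio⁻¹ ^ k * ‖iteratedFDeriv ℝ k u ((S.branch i).symm x)‖ := by
  have hrot : ContDiff ℝ k (u ∘ S.rotation.symm) :=
    (hu.comp S.rotation.symm.contDiff).of_le (by exact_mod_cast le_top)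
  have hshift := iteratedFDeriv_comp_sub (𝕜 := ℝ)
    (f := fun y => (u ∘ S.rotation.symm) (S.ratio⁻¹ • y)) k (S.center i) x
  simp only [branch_symm_apply, Function.comp_apply] at hshift ⊢
  rw [hshift]
  change ‖iteratedFDeriv ℝ k (fun y => (u ∘ S.rotation.symm) (S.ratio⁻¹ • y)) _‖ = _
  rw [iteratedFDeriv_comp_const_smul _ hrot, norm_smul,
    LinearIsometryEquiv.norm_iteratedFDeriv_comp_right, norm_pow, norm_inv,
    Real.norm_of_nonneg S.ratio_pos.le]

theorem Separates.exists_forall_ne_symm_notMem [Nonempty ι] (hC : S.Separates C) (x : E) :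
    ∃ i, ∀ j ≠ i, (S.branch j).symm x ∉ C := by
  by_cases h : ∃ i, (S.branch i).symm x ∈ C
  · obtain ⟨i, hi⟩ := h
    exact ⟨i, fun j hj hxj => hj (hC.eq_of_mem hxj hi)⟩
  · exact ⟨Classical.arbitrary ι, fun j _ hj => h ⟨j, hj⟩⟩

variable [Fintype ι]

theorem contDiff_transfer (hu : ContDiff ℝ ∞ u) : ContDiff ℝ ∞ (S.transfer q u) :=
  (ContDiff.sum fun i _ => hu.comp (S.contDiff_branch_symm i)).const_smul q

theorem support_transfer_subset (hC : S.Separates C) (hu : Function.support u ⊆ C) :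
    Function.support (S.transfer q u) ⊆ C := by
  rw [Function.support_subset_iff'] at hu ⊢
  intro x hx
  have hterm : ∀ i, u ((S.branch i).symm x) = 0 := fun i => hu _ fun hi => hx (by
    simpa only [Equiv.apply_symm_apply] using hC.mapsTo i hi)
  simp only [transfer, hterm, Finset.sum_const_zero, smul_zero]

theorem support_iterate_transfer_subset (hC : S.Separates C) (hψ : Function.support ψ ⊆ C)
    (n : ℕ) : Function.support ((S.transfer q)^[n] ψ) ⊆ C := by
  induction n with
  | zero => exact hψ
  | succ n ih =>
    rw [Function.iterate_succ_apply']
    exact support_transfer_subset hC ih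

theorem transfer_eq_single (hu : Function.support u ⊆ C) {i : ι}
    (hx : ∀ j ≠ i, (S.branch j).symm x ∉ C) :
    S.transfer q u x = q • u ((S.branch i).symm x) := by
  rw [transfer, Finset.sum_eq_single_of_mem i (Finset.mem_univ i) fun j _ hj =>
    Function.support_subset_iff'.1 hu _ (hx j hj)]

theorem transfer_eventuallyEq (hC : IsClosed C) (hu : Function.support u ⊆ C) {i : ι}
    (hx : ∀ j ≠ i, (S.branch j).symm x ∉ C) :
    S.transfer q u =ᶠ[𝓝 x] fun y => q • u ((S.branch i).symm y) := by
  have hev : ∀ᶠ y in 𝓝 x, ∀ j, j ≠ i → (S.branch j).symm y ∉ C := by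
    refine eventually_all.2 fun j => eventually_imp_distrib_left.2 fun hj => ?_
    exact (S.contDiff_branch_symm j (n := 0)).continuous.continuousAt.eventually
      (hC.isOpen_compl.mem_nhds (hx j hj))
  exact hev.mono fun y hy => transfer_eq_single hu hy

theorem transfer_branch (hC : S.Separates C) (hu : Function.support u ⊆ C) (i : ι) (hx : x ∈ C) :
    S.transfer q u (S.branch i x) = q • u x := by
  rw [transfer_eq_single hu (i := i), Equiv.symm_apply_apply]
  intro j hj hxj
  exact hj (hC.eq_of_mem hxj (by rwa [Equiv.symm_apply_apply]))

theorem norm_iteratedFDeriv_transfer_le [Nonempty ι] (hC : S.Separates C)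
    (hq : 0 ≤ q) (hu : ContDiff ℝ ∞ u)
    (hsupp : Function.support u ⊆ C) {k : ℕ} {A : ℝ} (hA : ∀ x, ‖iteratedFDeriv ℝ k u x‖ ≤ A)
    (x : E) : ‖iteratedFDeriv ℝ k (S.transfer q u) x‖ ≤ S.ratio⁻¹ ^ k * q * A := by
  obtain ⟨i, hi⟩ := hC.exists_forall_ne_symm_notMem x
  have hcomp : ContDiff ℝ k fun y => u ((S.branch i).symm y) :=
    (hu.comp (S.contDiff_branch_symm i)).of_le (by exact_mod_cast le_top)
  rw [((transfer_eventuallyEq hC.isClosed hsupp hi).iteratedFDeriv ℝ k).eq_of_nhds,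
    iteratedFDeriv_const_smul_apply' hcomp.contDiffAt, norm_smul,
    norm_iteratedFDeriv_comp_branch_symm S i hu, Real.norm_of_nonneg hq]
  have := S.ratio_pos
  calc q * (S.ratio⁻¹ ^ k * ‖iteratedFDeriv ℝ k u ((S.branch i).symm x)‖)
      ≤ q * (S.ratio⁻¹ ^ k * A) := by gcongr; exact hA _
    _ = S.ratio⁻¹ ^ k * q * A := by ring

theorem isScaleSequence_iterate_transfer [Nonempty ι] (hC : S.Separates C)
    (hq : 0 ≤ q) (hψ : ContDiff ℝ ∞ ψ)
    (hsupp : Function.support ψ ⊆ C) (hcomp : HasCompactSupport ψ) :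
    IsScaleSequence S.ratio⁻¹ q fun n => (S.transfer q)^[n] ψ := by
  have hsmooth (n : ℕ) : ContDiff ℝ ∞ ((S.transfer q)^[n] ψ) := by
    induction n with
    | zero => exact hψ
    | succ n ih =>
      rw [Function.iterate_succ_apply']
      exact contDiff_transfer ih
  refine ⟨hsmooth, fun k => ?_⟩
  obtain ⟨A, hA⟩ := (hψ.continuous_iteratedFDeriv (m := k)
    (by exact_mod_cast le_top)).bounded_above_of_compact_support (hcomp.iteratedFDeriv k)
  refine ⟨A, fun n => ?_⟩
  induction n with
  | zero => simpa using hA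
  | succ n ih =>
    intro x
    rw [Function.iterate_succ_apply']
    exact (norm_iteratedFDeriv_transfer_le hC hq (hsmooth n)
      (support_iterate_transfer_subset hC hsupp n) ih x).trans_eq (by ring)

/-- The solution `W = ∑ n, (transfer q)ⁿ ψ` of the self-similarity equation
`W = ψ + transfer q W`. -/
def selfSimilarSum (S : SimilaritySystem ι E) (q : ℝ) (ψ : E → G) (x : E) : G :=
  ∑' n, (S.transfer q)^[n] ψ x

theorem support_selfSimilarSum_subset (hC : S.Separates C) (hψ : Function.support ψ ⊆ C) :
    Function.support (S.selfSimilarSum q ψ) ⊆ C := by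
  refine Function.support_subset_iff'.2 fun x hx => ?_
  have hterm : ∀ n, (S.transfer q)^[n] ψ x = 0 := fun n =>
    Function.support_subset_iff'.1 (support_iterate_transfer_subset hC hψ n) x hx
  simp only [selfSimilarSum, hterm, tsum_zero]

theorem selfSimilarSum_eq [Nonempty ι] [CompleteSpace G] (hC : S.Separates C) (hq₀ : 0 ≤ q)
    (hq₁ : q < 1) (hψ : ContDiff ℝ ∞ ψ) (hsupp : Function.support ψ ⊆ C)
    (hcomp : HasCompactSupport ψ) (x : E) :
    S.selfSimilarSum q ψ x = ψ x + S.transfer q (S.selfSimilarSum q ψ) x := by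
  have hsum (x : E) : Summable fun n => (S.transfer q)^[n] ψ x := by
    obtain ⟨A, hA⟩ := (isScaleSequence_iterate_transfer hC hq₀ hψ hsupp hcomp).exists_bound 0
    exact .of_norm_bounded ((summable_geometric_of_lt_one hq₀ hq₁).mul_left A) fun n => by
      simpa using hA n x
  rw [selfSimilarSum, (hsum x).tsum_eq_zero_add]
  simp only [Function.iterate_zero, id, Function.iterate_succ_apply', transfer, selfSimilarSum]
  rw [Summable.tsum_const_smul _ (summable_sum fun i _ => hsum _),
    Summable.tsum_finsetSum fun i _ => hsum _]

end SimilaritySystem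

end SelfSimilar

section LimitSet

theorem isPreconnected_iInter_of_antitone {X : Type*} [TopologicalSpace X] [T2Space X]
    {K : ℕ → Set X} (hK : Antitone K) (hc : ∀ n, IsCompact (K n))
    (hp : ∀ n, IsPreconnected (K n)) : IsPreconnected (⋂ n, K n) := by
  have hcomp : IsCompact (⋂ n, K n) :=
    (hc 0).of_isClosed_subset (isClosed_iInter fun n => (hc n).isClosed) (iInter_subset _ 0)
  rw [isPreconnected_closed_iff]
  intro a b ha hb hab ⟨x, hx, hxa⟩ ⟨y, hy, hyb⟩
  by_contra hne
  have hdis : Disjoint ((⋂ n, K n) ∩ a) ((⋂ n, K n) ∩ b) :=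
    Set.disjoint_left.2 fun z hz hz' => hne ⟨z, hz.1, hz.2, hz'.2⟩
  obtain ⟨U, V, hU, hV, haU, hbV, hUV⟩ :=
    SeparatedNhds.of_isCompact_isCompact (hcomp.inter_right ha) (hcomp.inter_right hb) hdis
  have hsub : ⋂ n, K n ⊆ U ∪ V := fun z hz =>
    (hab hz).imp (fun h => haU ⟨hz, h⟩) fun h => hbV ⟨hz, h⟩
  obtain ⟨n, hn⟩ := exists_subset_nhds_of_isCompact hK.directed_ge hc fun z hz =>
    (hU.union hV).mem_nhds (hsub hz)
  obtain ⟨z, -, hzU, hzV⟩ := hp n U V hU hV hn ⟨x, mem_iInter.1 hx n, haU ⟨hx, hxa⟩⟩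
    ⟨y, mem_iInter.1 hy n, hbV ⟨hy, hyb⟩⟩
  exact Set.disjoint_left.1 hUV hzU hzV

namespace SimilaritySystem

variable {ι E G : Type*} [NormedAddCommGroup E] [NormedSpace ℝ E] [NormedAddCommGroup G]
  [NormedSpace ℝ G] {S : SimilaritySystem ι E} {B J : Set E}

/-- The `n`-th approximation of `S.limitSet B J`: every stage consists of a copy of the preceding
one in the image of each similarity, together with the set `J` that joins these copies. -/
def stage (S : SimilaritySystem ι E) (B J : Set E) : ℕ → Set E
  | 0 => B
  | n + 1 => J ∪ ⋃ i, S.branch i '' stage S B J n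

/-- The largest subset `K` of `B` with `K = J ∪ ⋃ i, S.branch i '' K`, as an intersection of
approximations. -/
def limitSet (S : SimilaritySystem ι E) (B J : Set E) : Set E :=
  ⋂ n, S.stage B J n

theorem stage_succ (n : ℕ) : S.stage B J (n + 1) = J ∪ ⋃ i, S.branch i '' S.stage B J n :=
  rfl

theorem antitone_stage (hB : ∀ i, MapsTo (S.branch i) B B) (hJ : J ⊆ B) :
    Antitone (S.stage B J) := by
  refine antitone_nat_of_succ_le fun n => ?_
  induction n with
  | zero => exact union_subset hJ (iUnion_subset fun i => (hB i).image_subset)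
  | succ n ih => exact union_subset_union_right J (iUnion_mono fun i => image_mono ih)

theorem isCompact_stage [Finite ι] (hB : IsCompact B) (hJ : IsCompact J) (n : ℕ) :
    IsCompact (S.stage B J n) := by
  induction n with
  | zero => exact hB
  | succ n ih =>
    exact hJ.union (isCompact_iUnion fun i => ih.image (S.contDiff_branch i (n := 0)).continuous)

theorem isCompact_limitSet [Finite ι] (hB : IsCompact B) (hJ : IsCompact J) :
    IsCompact (S.limitSet B J) :=
  hB.of_isClosed_subset (isClosed_iInter fun n => (isCompact_stage hB hJ n).isClosed)
    (iInter_subset _ 0)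

theorem norm_fderiv_branch {F : E → G} (hF : Differentiable ℝ F) {q : ℝ} (hq : 0 ≤ q) {b : G}
    {i : ι} (hBF : ∀ y ∈ B, F (S.branch i y) = b + q • F y) (hB : UniqueDiffOn ℝ B) {y : E}
    (hy : y ∈ B) :
    ‖fderiv ℝ F (S.branch i y)‖ = q / S.ratio * ‖fderiv ℝ F y‖ := by
  have hbranch : HasFDerivAt (S.branch i) (S.ratio • (S.rotation : E →L[ℝ] E)) y :=
    ((S.rotation : E →L[ℝ] E).hasFDerivAt.const_smul S.ratio).const_add (S.center i)
  have hchain : HasFDerivAt (F ∘ S.branch i)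
      (S.ratio • (fderiv ℝ F (S.branch i y)).comp (S.rotation : E →L[ℝ] E)) y := by
    simpa only [ContinuousLinearMap.comp_smul] using (hF _).hasFDerivAt.comp y hbranch
  have hscale : HasFDerivWithinAt (F ∘ S.branch i) (q • fderiv ℝ F y) B y :=
    (((hF y).hasFDerivAt.const_smul q).const_add b).hasFDerivWithinAt.congr hBF (hBF y hy)
  have heq := congrArg norm ((hB y hy).eq hchain.hasFDerivWithinAt hscale)
  rw [norm_smul, norm_smul, ContinuousLinearMap.opNorm_comp_linearIsometryEquiv,
    Real.norm_of_nonneg hq, Real.norm_of_nonneg S.ratio_pos.le] at heq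
  rw [div_mul_eq_mul_div, ← heq, mul_div_cancel_left₀ _ S.ratio_pos.ne']

theorem norm_fderiv_le_of_mem_stage {F : E → G} (hF : Differentiable ℝ F) {q M : ℝ} (hq : 0 ≤ q)
    {b : ι → G} (hBF : ∀ i, ∀ y ∈ B, F (S.branch i y) = b i + q • F y)
    (hB : ∀ i, MapsTo (S.branch i) B B) (hBd : UniqueDiffOn ℝ B) (hBM : ∀ y ∈ B, ‖fderiv ℝ F y‖ ≤ M)
    (hJB : J ⊆ B) (hJ : ∀ x ∈ J, fderiv ℝ F x = 0) (n : ℕ) :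
    ∀ x ∈ S.stage B J n, ‖fderiv ℝ F x‖ ≤ (q / S.ratio) ^ n * M := by
  have hratio : 0 ≤ q / S.ratio := div_nonneg hq S.ratio_pos.le
  induction n with
  | zero =>
    rw [pow_zero, one_mul]
    exact hBM
  | succ n ih =>
    rintro x (hx | hx)
    · have hM : 0 ≤ M := (norm_nonneg _).trans (hBM x (hJB hx))
      rw [hJ x hx, norm_zero]
      positivity
    · obtain ⟨i, y, hy, rfl⟩ := mem_iUnion.1 hx
      rw [norm_fderiv_branch hF hq (hBF i) hBd (antitone_stage hB hJB n.zero_le hy), pow_succ',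
        mul_assoc]
      exact mul_le_mul_of_nonneg_left (ih y hy) hratio

theorem fderiv_eq_zero_of_mem_limitSet {F : E → G} (hF : ContDiff ℝ 1 F) {q : ℝ} (hq : 0 ≤ q)
    (hqr : q < S.ratio) {b : ι → G} (hBF : ∀ i, ∀ y ∈ B, F (S.branch i y) = b i + q • F y)
    (hB : ∀ i, MapsTo (S.branch i) B B) (hBc : IsCompact B) (hBd : UniqueDiffOn ℝ B) (hJB : J ⊆ B)
    (hJ : ∀ x ∈ J, fderiv ℝ F x = 0) {x : E} (hx : x ∈ S.limitSet B J) : fderiv ℝ F x = 0 := by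
  obtain ⟨M, hM⟩ := hBc.exists_bound_of_continuousOn (hF.continuous_fderiv one_ne_zero).continuousOn
  have hbound := norm_fderiv_le_of_mem_stage (hF.differentiable one_ne_zero) hq hBF hB hBd hM hJB hJ
  have hlim : Tendsto (fun n => (q / S.ratio) ^ n * M) atTop (𝓝 0) := by
    simpa using (tendsto_pow_atTop_nhds_zero_of_lt_one (div_nonneg hq S.ratio_pos.le)
      ((div_lt_one S.ratio_pos).2 hqr)).mul_const M
  exact norm_le_zero_iff.1 (ge_of_tendsto' hlim fun n => hbound n x (mem_iInter.1 hx n))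

end SimilaritySystem

end LimitSet

section Whitney

/-- The shape of Whitney's example in dimension `m + 2`: the similarities contract by `mu`, and the
sides of the boxes in which they act form a geometric progression of ratio `lam`. -/
structure WhitneyShape (m : ℕ) where
  mu : ℝ
  lam : ℝ
  mu_pos : 0 < mu
  mu_lt_lam : mu < lam
  lam_pow : lam ^ (m + 2) = 1 / 2

namespace WhitneyShape

variable {m : ℕ} (P : WhitneyShape m) {r : ℝ} {ε : ℤˣ} {x : Model (m + 2)}

theorem lam_pos : 0 < P.lam := P.mu_pos.trans P.mu_lt_lam

/-- The images of the unit box keep the distance `gap` from the hyperplane `x 0 = 0`. -/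
def gap : ℝ := (1 - P.mu / P.lam) / 2

theorem mu_eq : P.mu = (1 - 2 * P.gap) * P.lam := by
  have := P.lam_pos.ne'
  rw [gap]
  field_simp
  ring

theorem gap_pos : 0 < P.gap :=
  half_pos (sub_pos.2 ((div_lt_one P.lam_pos).2 P.mu_lt_lam))

theorem gap_lt_half : P.gap < 1 / 2 := by
  have := div_pos P.mu_pos P.lam_pos
  rw [gap]
  linarith

/-- The box of size `r`. It is the direction of the long side that the similarities turn into the
next one, so that the small boxes fit into the large one for a contraction ratio close to
`2 ^ (-1 / (m + 2))`. -/
def box (r : ℝ) : Set (Model (m + 2)) := {x | ∀ i : Fin (m + 2), |x i| ≤ r * P.lam ^ (i : ℕ)}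

/-- The two similarities of Whitney's example. They permute the coordinate axes cyclically and
move the origin by `1 / 2` in opposite directions. -/
def system : SimilaritySystem ℤˣ (Model (m + 2)) where
  ratio := P.mu
  ratio_pos := P.mu_pos
  rotation := LinearIsometryEquiv.piLpCongrLeft 2 ℝ ℝ (finRotate (m + 2))
  center ε := EuclideanSpace.single 0 ((ε : ℤ) / 2 : ℝ)

theorem branch_zero : P.system.branch ε x 0 = (ε : ℤ) / 2 + P.mu * x (Fin.last (m + 1)) := by
  have : (finRotate (m + 2)).symm 0 = Fin.last (m + 1) := by
    rw [Equiv.symm_apply_eq, finRotate_last]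
  simp [SimilaritySystem.branch_apply, system, LinearIsometryEquiv.piLpCongrLeft_apply, this]

theorem branch_succ (j : Fin (m + 1)) : P.system.branch ε x j.succ = P.mu * x j.castSucc := by
  have : (finRotate (m + 2)).symm j.succ = j.castSucc := by
    rw [Equiv.symm_apply_eq, finRotate_apply, Fin.coeSucc_eq_succ]
  simp [SimilaritySystem.branch_apply, system, LinearIsometryEquiv.piLpCongrLeft_apply, this]

theorem branch_one : P.system.branch ε x 1 = P.mu * x 0 :=
  P.branch_succ 0

theorem units_int_eq_of_abs_sub_lt {ε ε' : ℤˣ} (h : |((ε : ℤ) / 2 - (ε' : ℤ) / 2 : ℝ)| < 1) :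
    ε = ε' := by
  rcases Int.units_eq_one_or ε with rfl | rfl <;> rcases Int.units_eq_one_or ε' with rfl | rfl <;>
    first | rfl | norm_num at h

theorem abs_branch_zero_sub_le (hx : x ∈ P.box r) :
    |P.system.branch ε x 0 - (ε : ℤ) / 2| ≤ (1 - 2 * P.gap) * r / 2 := by
  have hlast := mul_le_mul_of_nonneg_left (hx (Fin.last (m + 1))) P.mu_pos.le
  rw [branch_zero, add_sub_cancel_left, abs_mul, abs_of_pos P.mu_pos]
  refine hlast.trans_eq ?_
  have hpow := P.lam_pow
  rw [pow_succ'] at hpow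
  rw [Fin.val_last]
  linear_combination (1 - 2 * P.gap) * r * hpow + r * P.lam ^ (m + 1) * P.mu_eq

theorem abs_branch_succ_le (hx : x ∈ P.box r) (j : Fin (m + 1)) :
    |P.system.branch ε x j.succ| ≤ (1 - 2 * P.gap) * r * P.lam ^ (j + 1 : ℕ) := by
  rw [branch_succ, abs_mul, abs_of_pos P.mu_pos]
  refine (mul_le_mul_of_nonneg_left (hx j.castSucc) P.mu_pos.le).trans_eq ?_
  rw [P.mu_eq, Fin.val_castSucc]
  ring

theorem box_mono : Monotone P.box := fun _ _ h _ hx i =>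
  (hx i).trans (mul_le_mul_of_nonneg_right h (pow_pos P.lam_pos _).le)

theorem branch_mem_box (hr : r ≤ 1) (hx : x ∈ P.box r) :
    P.system.branch ε x ∈ P.box (1 - P.gap) := by
  have hgap := P.gap_lt_half
  have hε : |((ε : ℤ) / 2 : ℝ)| = 1 / 2 := by
    rcases Int.units_eq_one_or ε with rfl | rfl <;> norm_num
  have hr' : (1 - 2 * P.gap) * r ≤ (1 - 2 * P.gap) * 1 :=
    mul_le_mul_of_nonneg_left hr (by linarith)
  refine fun i => Fin.cases ?_ (fun j => ?_) i
  · have h₀ := P.abs_branch_zero_sub_le (ε := ε) hx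
    have := abs_sub_abs_le_abs_sub (P.system.branch ε x 0) ((ε : ℤ) / 2 : ℝ)
    rw [Fin.val_zero, pow_zero, mul_one]
    linarith
  · rw [Fin.val_succ]
    refine (P.abs_branch_succ_le hx j).trans (mul_le_mul_of_nonneg_right ?_ ?_)
    · linarith [P.gap_pos]
    · exact (pow_pos P.lam_pos _).le

theorem convex_box (r : ℝ) : Convex ℝ (P.box r) := by
  have : P.box r = ⋂ i : Fin (m + 2), EuclideanSpace.proj (𝕜 := ℝ) i ⁻¹'
      Metric.closedBall 0 (r * P.lam ^ (i : ℕ)) := by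
    ext x
    simp [box]
  rw [this]
  exact convex_iInter fun i => (convex_closedBall _ _).linear_preimage _

theorem isClosed_box (r : ℝ) : IsClosed (P.box r) := by
  simp only [box, Set.ofPred_forall]
  exact isClosed_iInter fun i => isClosed_le (by fun_prop) continuous_const

theorem isCompact_box (r : ℝ) : IsCompact (P.box r) := by
  have hcompact : IsCompact (Set.univ.pi fun i : Fin (m + 2) =>
      Icc (-(r * P.lam ^ (i : ℕ))) (r * P.lam ^ (i : ℕ))) :=
    isCompact_univ_pi fun _ => isCompact_Icc
  convert (EuclideanSpace.equiv (Fin (m + 2)) ℝ).toHomeomorph.isCompact_preimage.2 hcompact using 1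
  ext x
  simp [box, abs_le, Pi.le_def, forall_and]

theorem box_mem_nhds {r' : ℝ} (hr : r < r') (hx : x ∈ P.box r) : P.box r' ∈ 𝓝 x := by
  have hopen : IsOpen {y : Model (m + 2) | ∀ i : Fin (m + 2), |y i| < r' * P.lam ^ (i : ℕ)} := by
    simp only [Set.ofPred_forall]
    exact isOpen_iInter_of_finite fun i => isOpen_lt (by fun_prop) continuous_const
  refine mem_of_superset (hopen.mem_nhds fun i => (hx i).trans_lt ?_) fun y hy i => (hy i).le
  exact mul_lt_mul_of_pos_right hr (pow_pos P.lam_pos _)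

theorem separates_box (hr : 1 - P.gap ≤ r) (hr' : r ≤ 1) : P.system.Separates (P.box r) where
  isClosed := P.isClosed_box r
  mapsTo _ _ hx := P.box_mono hr (P.branch_mem_box hr' hx)
  eq_of_mem {ε ε' x} hx hx' := by
    have h := P.abs_branch_zero_sub_le (ε := ε) hx
    have h' := P.abs_branch_zero_sub_le (ε := ε') hx'
    rw [Equiv.apply_symm_apply] at h h'
    refine units_int_eq_of_abs_sub_lt ?_
    rw [abs_le] at h h'
    have := mul_le_mul_of_nonneg_left hr' (by linarith [P.gap_lt_half] : 0 ≤ 1 - 2 * P.gap)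
    rw [abs_lt]
    constructor <;> linarith [P.gap_pos]

/-- The smooth odd step function with value `-1` on `(-∞, -1/2]` and value `1` on `[1/2, ∞)`. -/
def step (t : ℝ) : ℝ := 2 * Real.smoothTransition (t + 1 / 2) - 1

/-- The smooth cutoff function with value `0` on `(-∞, 3/4]` and value `1` on `[1, ∞)`. -/
def gate (t : ℝ) : ℝ := Real.smoothTransition (4 * t - 3)

@[fun_prop]
theorem contDiff_step : ContDiff ℝ ∞ step :=
  (contDiff_const.mul (Real.smoothTransition.contDiff.comp (by fun_prop))).sub contDiff_const

@[fun_prop]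
theorem contDiff_gate : ContDiff ℝ ∞ gate :=
  Real.smoothTransition.contDiff.comp (by fun_prop)

theorem step_eq {t : ℝ} (h : 1 / 2 ≤ ε * t) : step t = ε := by
  rcases Int.units_eq_one_or ε with rfl | rfl
  · rw [step, Real.smoothTransition.one_of_one_le] <;> norm_num at h ⊢
    linarith
  · rw [step, Real.smoothTransition.zero_of_nonpos] <;> norm_num at h ⊢
    linarith

theorem gate_eq_zero {t : ℝ} (h : t ≤ 3 / 4) : gate t = 0 :=
  Real.smoothTransition.zero_of_nonpos (by linarith)

theorem gate_eq_one {t : ℝ} (h : 1 ≤ t) : gate t = 1 :=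
  Real.smoothTransition.one_of_one_le (by linarith)

/-- A smooth function with value `1` on the box of size `r` and support in the box of size `R`. -/
def cutoff (r R : ℝ) (x : Model (m + 2)) : ℝ :=
  ∏ i : Fin (m + 2),
    Real.smoothTransition ((R ^ 2 - (x i / P.lam ^ (i : ℕ)) ^ 2) / (R ^ 2 - r ^ 2))

@[fun_prop]
theorem contDiff_cutoff (r R : ℝ) : ContDiff ℝ ∞ (P.cutoff r R) :=
  contDiff_prod fun i _ => Real.smoothTransition.contDiff.comp (by fun_prop)

theorem cutoff_eq_one {R : ℝ} (hr : 0 ≤ r) (hrR : r < R) (hx : x ∈ P.box r) :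
    P.cutoff r R x = 1 := by
  refine Finset.prod_eq_one fun i _ => Real.smoothTransition.one_of_one_le ?_
  have hlam : 0 < P.lam ^ (i : ℕ) := pow_pos P.lam_pos _
  have hsq : (x i / P.lam ^ (i : ℕ)) ^ 2 ≤ r ^ 2 := by
    refine sq_le_sq' ?_ ?_
    · rw [le_div_iff₀ hlam, neg_mul]
      exact neg_le_of_abs_le (hx i)
    · rw [div_le_iff₀ hlam]
      exact le_of_abs_le (hx i)
  rw [one_le_div (sub_pos.2 (pow_lt_pow_left₀ hrR hr two_ne_zero))]
  linarith

theorem support_cutoff_subset {R : ℝ} (hr : 0 ≤ r) (hrR : r < R) :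
    Function.support (P.cutoff r R) ⊆ P.box R := by
  refine Function.support_subset_iff'.2 fun x hx => ?_
  obtain ⟨i, hi⟩ := not_forall.1 hx
  refine Finset.prod_eq_zero (Finset.mem_univ i) (Real.smoothTransition.zero_of_nonpos ?_)
  have hlam : 0 < P.lam ^ (i : ℕ) := pow_pos P.lam_pos _
  have hsq : R ^ 2 ≤ (x i / P.lam ^ (i : ℕ)) ^ 2 := by
    rw [← sq_abs (x i / _), abs_div, abs_of_pos hlam]
    exact pow_le_pow_left₀ (hr.trans hrR.le) ((le_div_iff₀ hlam).2 (not_le.1 hi).le) 2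
  exact div_nonpos_of_nonpos_of_nonneg (by linarith)
    (sub_nonneg.2 (pow_le_pow_left₀ hr hrR.le 2))

/-- The function from which the self-similar corrections start: a compactly supported extension of
`step (x 0)`. -/
def outer (x : Model (m + 2)) : ℝ := P.cutoff 2 3 x * step (x 0)

/-- The prescribed values of Whitney's function away from the images of the box: they are locally
constant along `bridge` and `tip`, and equal to `ε / 2 + outer y / 2` at the image
`P.system.branch ε y` of a point of the box. -/
def gluing (x : Model (m + 2)) : ℝ :=
  ∑ ε : ℤˣ, gate (ε * (x 0 / P.gap)) * ((ε + step (x 1 / P.mu)) / 2)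

/-- The correction of `outer` to `gluing` inside the box. -/
def seed (x : Model (m + 2)) : ℝ :=
  P.cutoff (1 - P.gap / 2) (1 - P.gap / 3) x * (P.gluing x - P.outer x)

/-- Whitney's function: the correction `seed` is repeated, at half the height, in the image of each
similarity, then in the images of these images, and so on. -/
def whitney (x : Model (m + 2)) : ℝ := P.outer x + P.system.selfSimilarSum (1 / 2) P.seed x

/-- The set that joins the images of the box under the two similarities. -/
def bridge : Set (Model (m + 2)) :=
  P.box (1 - P.gap) ∩ (fun x => x 0) ⁻¹' Icc (-P.gap) P.gap ∩
    (fun x => P.gap * x 1 + P.mu * x 0) ⁻¹' {0}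

/-- The set that joins the image of the box under the similarity `ε` to the corner `port ε`. -/
def tip (ε : ℤˣ) : Set (Model (m + 2)) :=
  P.box 1 ∩ (fun x => ε * x 0) ⁻¹' Ici (1 - P.gap) ∩ (fun x => ε * x 1) ⁻¹' Ici P.mu

/-- Two opposite corners of the box. -/
def port (ε : ℤˣ) : Model (m + 2) := WithLp.toLp 2 fun i : Fin (m + 2) => ε * P.lam ^ (i : ℕ)

theorem contDiff_outer : ContDiff ℝ ∞ P.outer :=
  (P.contDiff_cutoff 2 3).mul (contDiff_step.comp (by fun_prop))

theorem outer_eq (hx : x ∈ P.box 2) : P.outer x = step (x 0) := by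
  rw [outer, P.cutoff_eq_one two_pos.le (by norm_num) hx, one_mul]

theorem contDiff_seed : ContDiff ℝ ∞ P.seed := by
  have hgluing : ContDiff ℝ ∞ P.gluing := ContDiff.sum fun ε _ =>
    (contDiff_gate.comp (by fun_prop)).mul
      ((contDiff_const.add (contDiff_step.comp (by fun_prop))).div_const 2)
  exact (P.contDiff_cutoff _ _).mul (hgluing.sub P.contDiff_outer)

theorem support_seed_subset : Function.support P.seed ⊆ P.box (1 - P.gap / 3) := by
  have hgap := P.gap_pos
  have hgap' := P.gap_lt_half
  exact (Function.support_mul_subset_left _ _).trans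
    (P.support_cutoff_subset (by linarith) (by linarith))

theorem hasCompactSupport_of_support_subset_box {u : Model (m + 2) → ℝ}
    (hu : Function.support u ⊆ P.box r) : HasCompactSupport u :=
  (P.isCompact_box r).of_isClosed_subset (isClosed_tsupport u)
    (closure_minimal hu (P.isClosed_box r))

theorem separates_box_seed : P.system.Separates (P.box (1 - P.gap / 3)) :=
  P.separates_box (by linarith [P.gap_pos]) (by linarith [P.gap_pos])

theorem whitney_eq (x : Model (m + 2)) :
    P.whitney x = P.outer x + P.seed x +
      P.system.transfer (1 / 2) (P.system.selfSimilarSum (1 / 2) P.seed) x := by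
  rw [whitney, SimilaritySystem.selfSimilarSum_eq P.separates_box_seed (by norm_num) (by norm_num)
    P.contDiff_seed P.support_seed_subset
    (P.hasCompactSupport_of_support_subset_box P.support_seed_subset), add_assoc]

theorem outer_add_seed_eq (hx : x ∈ P.box (1 - P.gap / 2)) :
    P.outer x + P.seed x = P.gluing x := by
  rw [seed, P.cutoff_eq_one (by linarith [P.gap_lt_half]) (by linarith [P.gap_pos]) hx, one_mul,
    add_sub_cancel]

theorem gluing_eq_single (h₁ : P.gap ≤ ε * x 0) :
    P.gluing x = (ε + step (x 1 / P.mu)) / 2 := by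
  have hopen : 1 ≤ ε * (x 0 / P.gap) := by
    rwa [← mul_div_assoc, one_le_div P.gap_pos]
  have hclosed : ∀ ε' ≠ ε, gate ((ε' : ℤ) * (x 0 / P.gap)) = 0 := fun ε' hε' => by
    rw [Int.units_ne_iff_eq_neg.1 hε']
    refine gate_eq_zero ?_
    push_cast
    linarith
  rw [gluing, Fintype.sum_eq_single ε fun ε' hε' => by rw [hclosed ε' hε', zero_mul],
    gate_eq_one hopen, one_mul]

theorem whitney_branch (hx : x ∈ P.box 1) :
    P.whitney (P.system.branch ε x) = (ε : ℤ) / 2 + (1 / 2 : ℝ) • P.whitney x := by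
  have hgap := P.gap_pos
  have hbranch := P.branch_mem_box (ε := ε) le_rfl hx
  have hsupp := (SimilaritySystem.support_selfSimilarSum_subset (q := 1 / 2) P.separates_box_seed
    P.support_seed_subset).trans (P.box_mono (by linarith : 1 - P.gap / 3 ≤ 1))
  have hzero : P.gap ≤ ε * P.system.branch ε x 0 := by
    have h := abs_le.1 (P.abs_branch_zero_sub_le (ε := ε) hx)
    rcases Int.units_eq_one_or ε with rfl | rfl <;> push_cast at h ⊢ <;> linarith
  have hone : P.system.branch ε x 1 / P.mu = x 0 := by
    rw [branch_one, mul_div_cancel_left₀ _ P.mu_pos.ne']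
  rw [whitney_eq, P.outer_add_seed_eq (P.box_mono (by linarith) hbranch), P.gluing_eq_single hzero,
    hone, SimilaritySystem.transfer_branch (P.separates_box (by linarith) le_rfl) hsupp ε hx,
    whitney, P.outer_eq (P.box_mono one_le_two hx), smul_eq_mul, smul_eq_mul]
  ring

theorem whitney_eventuallyEq_of_forall_notMem
    (hx : ∀ ε, (P.system.branch ε).symm x ∉ P.box (1 - P.gap / 3)) :
    P.whitney =ᶠ[𝓝 x] fun y => P.outer y + P.seed y := by
  have hsupp := SimilaritySystem.support_selfSimilarSum_subset (q := 1 / 2) P.separates_box_seed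
    P.support_seed_subset
  have htransfer := SimilaritySystem.transfer_eventuallyEq (q := 1 / 2) (i := 1)
    P.separates_box_seed.isClosed hsupp fun ε _ => hx ε
  have hev : ∀ᶠ y in 𝓝 x, (P.system.branch 1).symm y ∉ P.box (1 - P.gap / 3) :=
    (P.system.contDiff_branch_symm 1 (n := 0)).continuous.continuousAt.eventually
      (P.separates_box_seed.isClosed.isOpen_compl.mem_nhds (hx 1))
  filter_upwards [htransfer, hev] with y hy hy'
  rw [whitney_eq, hy, Function.support_subset_iff'.1 hsupp _ hy', smul_zero, add_zero]

theorem whitney_eventuallyEq_zero (hx : x ∈ P.bridge) : P.whitney =ᶠ[𝓝 x] 0 := by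
  obtain ⟨⟨hbox, hx₀⟩, hx₁⟩ := hx
  have hgap := P.gap_pos
  have hmu := P.mu_pos
  have hx₁ : x 1 / P.mu = -(x 0 / P.gap) := by
    rw [mem_preimage, mem_singleton_iff] at hx₁
    field_simp
    linarith
  have hout : ∀ ε, (P.system.branch ε).symm x ∉ P.box (1 - P.gap / 3) := fun ε hε => by
    have h := abs_le.1 (P.abs_branch_zero_sub_le (ε := ε) hε)
    rw [Equiv.apply_symm_apply] at h
    have hprod := mul_pos hgap (sub_pos.2 P.gap_lt_half)
    rcases Int.units_eq_one_or ε with rfl | rfl <;> push_cast at h <;>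
      nlinarith [hx₀.1, hx₀.2]
  have hterm (ε : ℤˣ) : ∀ᶠ y : Model (m + 2) in 𝓝 x,
      gate (ε * (y 0 / P.gap)) * ((ε + step (y 1 / P.mu)) / 2) = 0 := by
    rcases lt_or_ge ((ε : ℤ) * (x 0 / P.gap) : ℝ) (3 / 4) with h | h
    · have : ∀ᶠ y : Model (m + 2) in 𝓝 x, (ε * (y 0 / P.gap) : ℝ) < 3 / 4 :=
        ContinuousAt.eventually_lt (by fun_prop) continuousAt_const h
      exact this.mono fun y hy => by rw [gate_eq_zero hy.le, zero_mul]
    · have : ∀ᶠ y : Model (m + 2) in 𝓝 x, 1 / 2 < (((-ε : ℤˣ) : ℤ) : ℝ) * (y 1 / P.mu) :=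
        ContinuousAt.eventually_lt continuousAt_const (by fun_prop) (by
          rw [hx₁, Units.val_neg]
          push_cast
          linarith)
      exact this.mono fun y hy => by rw [step_eq hy.le, Units.val_neg]; simp
  filter_upwards [P.whitney_eventuallyEq_of_forall_notMem hout, eventually_all.2 hterm,
    P.box_mem_nhds (by linarith : 1 - P.gap < 1 - P.gap / 2) hbox] with y hy hy' hybox
  rw [hy, P.outer_add_seed_eq hybox]
  exact Finset.sum_eq_zero fun ε _ => hy' ε

theorem whitney_eventuallyEq_of_mem_tip (hx : x ∈ P.tip ε) :
    P.whitney =ᶠ[𝓝 x] fun _ => (ε : ℝ) := by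
  obtain ⟨⟨hbox, hx₀⟩, hx₁⟩ := hx
  rw [mem_preimage, mem_Ici] at hx₀ hx₁
  have hgap := P.gap_pos
  have hgap' := P.gap_lt_half
  have hmu := P.mu_pos
  have hout : ∀ ε', (P.system.branch ε').symm x ∉ P.box (1 - P.gap / 3) := fun ε' hε' => by
    have hzero := abs_le.1 (hε' 0)
    have hone := P.branch_one (ε := ε') (x := (P.system.branch ε').symm x)
    rw [Equiv.apply_symm_apply] at hone
    rw [Fin.val_zero, pow_zero, mul_one] at hzero
    rw [hone] at hx₁
    have hprod := mul_pos hmu hgap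
    rcases Int.units_eq_one_or ε with rfl | rfl <;> push_cast at hx₁ <;> nlinarith
  have hev₀ : ∀ᶠ y : Model (m + 2) in 𝓝 x, 1 / 2 < (ε : ℝ) * y 0 ∧ P.gap < ε * y 0 := by
    refine .and ?_ ?_ <;>
    exact ContinuousAt.eventually_lt continuousAt_const (by fun_prop) (by linarith)
  have hev₁ : ∀ᶠ y : Model (m + 2) in 𝓝 x, 1 / 2 < (ε : ℝ) * (y 1 / P.mu) :=
    ContinuousAt.eventually_lt continuousAt_const (by fun_prop) (by
      rw [← mul_div_assoc, lt_div_iff₀ hmu]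
      linarith)
  filter_upwards [P.whitney_eventuallyEq_of_forall_notMem hout, hev₀, hev₁,
    P.box_mem_nhds one_lt_two hbox] with y hy hy₀ hy₁ hybox
  rw [hy, seed, P.outer_eq hybox, P.gluing_eq_single hy₀.2.le, step_eq hy₀.1.le, step_eq hy₁.le]
  ring

theorem isCompact_bridge : IsCompact P.bridge :=
  ((P.isCompact_box _).inter_right (isClosed_Icc.preimage (by fun_prop))).inter_right
    (isClosed_singleton.preimage (by fun_prop))

theorem isCompact_tip (ε : ℤˣ) : IsCompact (P.tip ε) :=
  ((P.isCompact_box _).inter_right (isClosed_Ici.preimage (by fun_prop))).inter_right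
    (isClosed_Ici.preimage (by fun_prop))

theorem isPreconnected_bridge : IsPreconnected P.bridge := by
  let ℓ : Model (m + 2) →L[ℝ] ℝ := P.gap • EuclideanSpace.proj 1 + P.mu • EuclideanSpace.proj 0
  exact (((P.convex_box _).inter ((convex_Icc _ _).linear_preimage
    (EuclideanSpace.proj (𝕜 := ℝ) 0).toLinearMap)).inter
      ((convex_singleton 0).linear_preimage ℓ.toLinearMap)).isPreconnected

theorem isPreconnected_tip (ε : ℤˣ) : IsPreconnected (P.tip ε) := by
  let ℓ (i : Fin (m + 2)) : Model (m + 2) →L[ℝ] ℝ := (ε : ℝ) • EuclideanSpace.proj i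
  exact (((P.convex_box _).inter ((convex_Ici _).linear_preimage (ℓ 0).toLinearMap)).inter
    ((convex_Ici _).linear_preimage (ℓ 1).toLinearMap)).isPreconnected

theorem zero_mem_bridge : 0 ∈ P.bridge := by
  have hgap := P.gap_pos
  have hbox (i : Fin (m + 2)) : 0 ≤ (1 - P.gap) * P.lam ^ (i : ℕ) :=
    mul_nonneg (by linarith [P.gap_lt_half]) (pow_pos P.lam_pos _).le
  simp [bridge, box, hbox, hgap.le]

theorem port_mem_box : P.port ε ∈ P.box 1 := fun i => by
  have hpow := pow_pos P.lam_pos i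
  rcases Int.units_eq_one_or ε with rfl | rfl <;> simp [port, abs_of_pos hpow]

theorem port_mem_tip : P.port ε ∈ P.tip ε := by
  have hgap := P.gap_pos
  have hmu := P.mu_lt_lam
  refine ⟨⟨P.port_mem_box, ?_⟩, ?_⟩ <;>
    rcases Int.units_eq_one_or ε with rfl | rfl <;> simp [port, hgap.le, hmu.le]

theorem branch_port_zero {ε' : ℤˣ} :
    P.system.branch ε (P.port ε') 0 = ε / 2 + ε' * (1 / 2 - P.gap) := by
  have hpow := P.lam_pow
  rw [pow_succ'] at hpow
  simp only [branch_zero, port, Fin.val_last]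
  linear_combination (ε' : ℝ) * (P.lam ^ (m + 1) * P.mu_eq + (1 - 2 * P.gap) * hpow)

theorem branch_port_one {ε' : ℤˣ} : P.system.branch ε (P.port ε') 1 = P.mu * ε' := by
  rw [branch_one]
  simp [port]

theorem branch_port_mem_tip : P.system.branch ε (P.port ε) ∈ P.tip ε := by
  have hgap := P.gap_pos
  refine ⟨⟨P.box_mono (by linarith) (P.branch_mem_box le_rfl P.port_mem_box), ?_⟩, ?_⟩
  · rw [mem_preimage, branch_port_zero, mem_Ici]
    rcases Int.units_eq_one_or ε with rfl | rfl <;> push_cast <;> linarith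
  · rw [mem_preimage, branch_port_one, mem_Ici]
    rcases Int.units_eq_one_or ε with rfl | rfl <;> push_cast <;> linarith

theorem branch_port_neg_mem_bridge : P.system.branch ε (P.port (-ε)) ∈ P.bridge := by
  have hgap := P.gap_pos
  refine ⟨⟨P.branch_mem_box le_rfl P.port_mem_box, ?_⟩, ?_⟩
  · rw [mem_preimage, branch_port_zero, mem_Icc, Units.val_neg]
    rcases Int.units_eq_one_or ε with rfl | rfl <;> constructor <;> push_cast <;> linarith
  · rw [mem_preimage, branch_port_zero, branch_port_one, mem_singleton_iff, Units.val_neg]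
    push_cast
    ring

/-- The set that joins the images of the box to each other and to the corners `P.port ε`. -/
def joint : Set (Model (m + 2)) := P.bridge ∪ ⋃ ε, P.tip ε

theorem isCompact_joint : IsCompact P.joint :=
  P.isCompact_bridge.union (isCompact_iUnion P.isCompact_tip)

theorem joint_subset_box : P.joint ⊆ P.box 1 :=
  union_subset (fun _ hx => P.box_mono (by linarith [P.gap_pos]) hx.1.1)
    (iUnion_subset fun _ _ hx => hx.1.1)

theorem mapsTo_branch_box (ε : ℤˣ) : MapsTo (P.system.branch ε) (P.box 1) (P.box 1) :=
  (P.separates_box (by linarith [P.gap_pos]) le_rfl).mapsTo ε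

theorem port_mem_stage (n : ℕ) : P.port ε ∈ P.system.stage (P.box 1) P.joint n := by
  cases n with
  | zero => exact P.port_mem_box
  | succ n => exact Or.inl (Or.inr (mem_iUnion_of_mem ε P.port_mem_tip))

theorem isPreconnected_stage (n : ℕ) :
    IsPreconnected (P.system.stage (P.box 1) P.joint n) := by
  induction n with
  | zero => exact (P.convex_box 1).isPreconnected
  | succ n ih =>
    set T := P.system.stage (P.box 1) P.joint n
    have hunion : P.system.stage (P.box 1) P.joint (n + 1) =
        ⋃ ε, P.bridge ∪ P.system.branch ε '' T ∪ P.tip ε := by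
      rw [SimilaritySystem.stage_succ, iUnion_union_distrib, ← union_iUnion, union_right_comm]
      rfl
    have himage (ε : ℤˣ) : IsPreconnected (P.system.branch ε '' T) :=
      ih.image _ (P.system.contDiff_branch ε (n := 0)).continuous.continuousOn
    have hport (ε ε' : ℤˣ) : P.system.branch ε (P.port ε') ∈ P.system.branch ε '' T :=
      mem_image_of_mem _ (P.port_mem_stage n)
    rw [hunion]
    refine isPreconnected_iUnion ⟨0, mem_iInter.2 fun ε => .inl (.inl P.zero_mem_bridge)⟩
      fun ε => ?_
    exact (P.isPreconnected_bridge.union _ P.branch_port_neg_mem_bridge (hport ε (-ε))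
      (himage ε)).union _ (.inr (hport ε ε)) P.branch_port_mem_tip (P.isPreconnected_tip ε)

/-- Whitney's arc, the compact connected set of critical points of Whitney's function. -/
def arc : Set (Model (m + 2)) := P.system.limitSet (P.box 1) P.joint

theorem isCompact_arc : IsCompact P.arc :=
  SimilaritySystem.isCompact_limitSet (P.isCompact_box 1) P.isCompact_joint

theorem port_mem_arc : P.port ε ∈ P.arc :=
  mem_iInter.2 P.port_mem_stage

theorem isConnected_arc : IsConnected P.arc :=
  ⟨⟨P.port 1, P.port_mem_arc⟩, isPreconnected_iInter_of_antitone
    (SimilaritySystem.antitone_stage P.mapsTo_branch_box P.joint_subset_box)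
    (SimilaritySystem.isCompact_stage (P.isCompact_box 1) P.isCompact_joint)
    P.isPreconnected_stage⟩

theorem whitney_port : P.whitney (P.port ε) = ε :=
  (P.whitney_eventuallyEq_of_mem_tip P.port_mem_tip).eq_of_nhds

theorem hasCompactSupport_whitney : HasCompactSupport P.whitney := by
  have houter : Function.support P.outer ⊆ P.box 3 :=
    (Function.support_mul_subset_left _ _).trans
      (P.support_cutoff_subset two_pos.le (by norm_num))
  exact (P.hasCompactSupport_of_support_subset_box houter).add
    (P.hasCompactSupport_of_support_subset_box
      (SimilaritySystem.support_selfSimilarSum_subset P.separates_box_seed P.support_seed_subset))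

theorem ckHolderAt_whitney {k : ℕ} {s : ℝ≥0} (hs : s ≤ 1) (hks : P.mu⁻¹ ^ (k + s : ℝ) < 2)
    (x : Model (m + 2)) : CkHolderAt k s P.whitney x := by
  have hmu : 1 ≤ P.mu⁻¹ := by
    have hlam : P.lam < 1 := by
      refine lt_of_pow_lt_pow_left₀ (m + 2) zero_le_one ?_
      rw [P.lam_pow, one_pow]
      norm_num
    exact (one_le_inv₀ P.mu_pos).2 (P.mu_lt_lam.trans hlam).le
  refine (CkHolderAt.of_contDiffAt hs
    (P.contDiff_outer.contDiffAt.of_le (by exact_mod_cast le_top))).add ?_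
  exact (SimilaritySystem.isScaleSequence_iterate_transfer P.separates_box_seed (by norm_num)
    P.contDiff_seed P.support_seed_subset
    (P.hasCompactSupport_of_support_subset_box P.support_seed_subset)).ckHolderAt_tsum hmu
      (by norm_num) hs (by rwa [mul_one_div, div_lt_one two_pos]) x

theorem fderiv_whitney_eq_zero (hF : ContDiff ℝ 1 P.whitney) (hmu : 1 / 2 < P.mu)
    (hx : x ∈ P.arc) : fderiv ℝ P.whitney x = 0 := by
  have hjoint : ∀ x ∈ P.joint, fderiv ℝ P.whitney x = 0 := by
    rintro x (hx | hx)
    · rw [(P.whitney_eventuallyEq_zero hx).fderiv_eq, fderiv_zero, Pi.zero_apply]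
    · obtain ⟨ε, hε⟩ := mem_iUnion.1 hx
      rw [(P.whitney_eventuallyEq_of_mem_tip hε).fderiv_eq, fderiv_fun_const, Pi.zero_apply]
  have hnhds : P.box 1 ∈ 𝓝 (0 : Model (m + 2)) :=
    P.box_mem_nhds zero_lt_one fun i => by simp
  exact SimilaritySystem.fderiv_eq_zero_of_mem_limitSet hF (by norm_num) hmu
    (fun _ _ => P.whitney_branch) P.mapsTo_branch_box (P.isCompact_box 1)
    (uniqueDiffOn_convex (P.convex_box 1) ⟨0, mem_interior_iff_mem_nhds.2 hnhds⟩)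
    P.joint_subset_box hjoint hx

theorem exists_inv_mu_rpow_lt_two {β : ℝ} (hβ₀ : 0 ≤ β) (hβ : β < m + 2) :
    ∃ P : WhitneyShape m, ∀ t ≤ β, P.mu⁻¹ ^ t < 2 := by
  obtain ⟨β', hβ', hβ'm⟩ := exists_between hβ
  have hβ'₀ : 0 < β' := hβ₀.trans_lt hβ'
  have hlt : (2 : ℝ) ^ (-β'⁻¹) < 2 ^ (-(m + 2 : ℝ)⁻¹) :=
    Real.rpow_lt_rpow_of_exponent_lt one_lt_two (neg_lt_neg (inv_strictAnti₀ hβ'₀ hβ'm))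
  refine ⟨⟨2 ^ (-β'⁻¹), 2 ^ (-(m + 2 : ℝ)⁻¹), by positivity, hlt, ?_⟩, fun t ht => ?_⟩
  · rw [← Real.rpow_mul_natCast two_pos.le]
    push_cast
    rw [neg_mul, inv_mul_cancel₀ (by positivity), Real.rpow_neg_one, one_div]
  · change ((2 : ℝ) ^ (-β'⁻¹))⁻¹ ^ t < 2
    rw [Real.rpow_neg two_pos.le, inv_inv, ← Real.rpow_mul two_pos.le]
    exact Real.rpow_lt_self_of_one_lt one_lt_two
      ((inv_mul_lt_one₀ hβ'₀).2 (ht.trans_lt hβ'))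

end WhitneyShape

theorem exists_whitney_function {d : ℕ} (hd : 2 ≤ d) {β : ℝ} (hβ : β < d) :
    ∃ (K : Set (Model d)) (F : Model d → ℝ), IsCompact K ∧ IsConnected K ∧ HasCompactSupport F ∧
      (∀ (k : ℕ) (s : ℝ≥0), s ≤ 1 → k + s ≤ β → ∀ x, CkHolderAt k s F x) ∧
      (∀ x ∈ K, fderiv ℝ F x = 0) ∧ ∃ x ∈ K, ∃ y ∈ K, F x ≠ F y := by
  obtain ⟨m, rfl⟩ := Nat.exists_eq_add_of_le' hd
  have hβ' : max β 1 < m + 2 :=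
    max_lt (by exact_mod_cast hβ) (by linarith [m.cast_nonneg (α := ℝ)])
  obtain ⟨P, hP⟩ :=
    WhitneyShape.exists_inv_mu_rpow_lt_two (zero_le_one.trans (le_max_right β 1)) hβ'
  have hinv : P.mu⁻¹ < 2 := by simpa using hP 1 (le_max_right β 1)
  have hmu : 1 / 2 < P.mu := (one_div (2 : ℝ)).trans_lt ((inv_lt_comm₀ P.mu_pos two_pos).1 hinv)
  have hF : ContDiff ℝ 1 P.whitney := contDiff_iff_contDiffAt.2 fun x =>
    (P.ckHolderAt_whitney (k := 1) zero_le_one (by simpa using hinv) x).contDiffAt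
  refine ⟨P.arc, P.whitney, P.isCompact_arc, P.isConnected_arc, P.hasCompactSupport_whitney,
    fun k s hs hks => P.ckHolderAt_whitney hs (hP _ (hks.trans (le_max_left β 1))),
    fun x => P.fderiv_whitney_eq_zero hF hmu,
    P.port 1, P.port_mem_arc, P.port (-1), P.port_mem_arc, ?_⟩
  rw [P.whitney_port, P.whitney_port]
  norm_num

end Whitney

section Metric

theorem convex_setOf_symm_posDef {V : Type*} [AddCommGroup V] [TopologicalSpace V] [Module ℝ V] :
    Convex ℝ {B : V →L[ℝ] V →L[ℝ] ℝ | (∀ v w, B v w = B w v) ∧ ∀ v, v ≠ 0 → 0 < B v v} := by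
  rw [convex_iff_forall_pos]
  rintro B ⟨hB, hB'⟩ B₂ ⟨hB₂, hB₂'⟩ a b ha hb -
  refine ⟨fun v w => ?_, fun v hv => ?_⟩
  · simp [hB v w, hB₂ v w]
  · exact add_pos (mul_pos ha (hB' v hv)) (mul_pos hb (hB₂' v hv))

section PositiveForm

variable {V : Type*} [NormedAddCommGroup V] [NormedSpace ℝ V] [FiniteDimensional ℝ V]
  (B : V →L[ℝ] V →L[ℝ] ℝ) (hB : ∀ v, v ≠ 0 → 0 < B v v)
include hB

theorem inverse_apply_of_pos (v : V) : ContinuousLinearMap.inverse B (B v) = v := by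
  by_contra hne
  have h := hB _ (sub_ne_zero.2 hne)
  rw [map_sub B, apply_inverse_of_pos B hB, sub_self] at h
  exact lt_irrefl _ h

theorem isInvertible_of_pos : B.IsInvertible :=
  .of_inverse (g := ContinuousLinearMap.inverse B)
    (ContinuousLinearMap.ext (apply_inverse_of_pos B hB))
    (ContinuousLinearMap.ext (inverse_apply_of_pos B hB))

theorem exists_pos_mul_norm_sq_le_of_pos : ∃ c > 0, ∀ v, c * ‖v‖ ^ 2 ≤ B v v := by
  rcases subsingleton_or_nontrivial V with hV | hV
  · exact ⟨1, one_pos, fun v => by simp [Subsingleton.elim v 0]⟩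
  obtain ⟨v₀, hv₀, hmin⟩ := (isCompact_sphere (0 : V) 1).exists_isMinOn
    (NormedSpace.sphere_nonempty.2 zero_le_one)
    (f := fun v => B v v) (Continuous.continuousOn (by fun_prop))
  refine ⟨B v₀ v₀, hB v₀ (ne_zero_of_mem_unit_sphere ⟨v₀, hv₀⟩), fun v => ?_⟩
  rcases eq_or_ne v 0 with rfl | hv
  · simp
  have hn : 0 < ‖v‖ := norm_pos_iff.2 hv
  have hunit : B v₀ v₀ ≤ B (‖v‖⁻¹ • v) (‖v‖⁻¹ • v) := hmin (by simp [norm_smul, hn.ne'])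
  simp only [map_smul, smul_apply, smul_eq_mul] at hunit
  calc B v₀ v₀ * ‖v‖ ^ 2 ≤ (‖v‖⁻¹ * (‖v‖⁻¹ * B v v)) * ‖v‖ ^ 2 := by gcongr
    _ = B v v := by field_simp

theorem isVonNBounded_of_pos : Bornology.IsVonNBounded ℝ {v | B v v < 1} := by
  obtain ⟨c, hc, hlow⟩ := exists_pos_mul_norm_sq_le_of_pos B hB
  rw [NormedSpace.isVonNBounded_iff]
  refine (Metric.isBounded_closedBall (x := (0 : V)) (r := √(1 / c))).subset fun v hv => ?_
  rw [mem_closedBall_zero_iff]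
  refine Real.le_sqrt_of_sq_le ?_
  rw [le_div_iff₀ hc, mul_comm]
  exact ((hlow v).trans_lt hv).le

end PositiveForm

variable {d : ℕ} {M : Type*} [TopologicalSpace M] [ChartedSpace (Model d) M]
  [IsManifold (𝓡 d) ∞ M]

/-- The coordinates of a tangent vector at `q` in the preferred chart at `q₀`; zero when `q` is
outside the domain of that chart. -/
def tangentCoords (q₀ q : M) : TangentSpace (𝓡 d) q →L[ℝ] Model d :=
  (trivializationAt (Model d) (TangentSpace (𝓡 d)) q₀).continuousLinearMapAt ℝ q

/-- The coordinate frame at `q` of the preferred chart at `q₀`, the inverse of `tangentCoords`. -/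
def tangentFrame (q₀ q : M) : Model d →L[ℝ] TangentSpace (𝓡 d) q :=
  (trivializationAt (Model d) (TangentSpace (𝓡 d)) q₀).symmL ℝ q

theorem tangentCoords_tangentFrame {q₀ q : M} (hq : q ∈ (chartAt (Model d) q₀).source)
    (v : Model d) : tangentCoords q₀ q (tangentFrame q₀ q v) = v :=
  (trivializationAt (Model d) (TangentSpace (𝓡 d)) q₀).continuousLinearMapAt_symmL (R := ℝ) hq v

theorem tangentFrame_tangentCoords {q₀ q : M} (hq : q ∈ (chartAt (Model d) q₀).source)
    (v : TangentSpace (𝓡 d) q) : tangentFrame q₀ q (tangentCoords q₀ q v) = v :=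
  (trivializationAt (Model d) (TangentSpace (𝓡 d)) q₀).symmL_continuousLinearMapAt (R := ℝ) hq v

theorem tangentFrame_self (q : M) (v : Model d) : tangentFrame q q v = v := by
  rw [tangentFrame, TangentBundle.symmL_trivializationAt_eq_core (mem_chart_source _ _)]
  exact (tangentBundleCore (𝓡 d) M).coordChange_self _ _ (mem_chart_source _ _) v

/-- The coefficients of a covector in the preferred chart at `q₀`. -/
def covectorCoords (q₀ q : M) (p : CotangentSpace d q) : CoModel d :=
  ContinuousLinearMap.inCoordinates (Model d) (TangentSpace (𝓡 d) : M → Type _)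
    ℝ (fun _ : M => ℝ) q₀ q q₀ q p

/-- The coefficients of a bilinear form on `T_qM` in the preferred chart at `q₀`. -/
def bilinCoords (q₀ q : M) (B : TangentSpace (𝓡 d) q →L[ℝ] TangentSpace (𝓡 d) q →L[ℝ] ℝ) :
    Model d →L[ℝ] Model d →L[ℝ] ℝ :=
  ContinuousLinearMap.inCoordinates (Model d) (TangentSpace (𝓡 d) : M → Type _)
    (Model d →L[ℝ] ℝ) (fun q : M => TangentSpace (𝓡 d) q →L[ℝ] ℝ) q₀ q q₀ q B

theorem covectorCoords_apply {q₀ q : M} (hq : q ∈ (chartAt (Model d) q₀).source)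
    (p : CotangentSpace d q) (v : Model d) :
    covectorCoords q₀ q p v = p (tangentFrame q₀ q v) := by
  have := ContinuousLinearMap.inCoordinates_eq (F := Model d) (F' := ℝ)
    (E := (TangentSpace (𝓡 d) : M → Type _)) (E' := Bundle.Trivial M ℝ) (ϕ := p)
    (x₀ := q₀) (y₀ := q₀) (y := q) hq (mem_univ _)
  rw [tangentFrame, Trivialization.symmL_apply _ hq]
  exact congrArg (fun T : Model d →L[ℝ] ℝ => T v) this

theorem bilinCoords_apply {q₀ q : M} (hq : q ∈ (chartAt (Model d) q₀).source)
    (B : TangentSpace (𝓡 d) q →L[ℝ] TangentSpace (𝓡 d) q →L[ℝ] ℝ) (v w : Model d) :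
    bilinCoords q₀ q B v w = B (tangentFrame q₀ q v) (tangentFrame q₀ q w) := by
  have := inCoordinates_apply_eq₂ (F₁ := Model d) (F₂ := Model d) (F₃ := ℝ)
    (E₁ := (TangentSpace (𝓡 d) : M → Type _)) (E₂ := (TangentSpace (𝓡 d) : M → Type _))
    (E₃ := Bundle.Trivial M ℝ) (ϕ := B) (v := v) (w := w) hq hq (x₀ := q₀) (mem_univ _)
  rw [tangentFrame, Trivialization.symmL_apply _ hq, Trivialization.symmL_apply _ hq]
  exact this.trans (LinearMap.congr_fun (Trivial.linearMapAt_trivialization ℝ M ℝ q) _)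

theorem contMDiffAt_covectorCoords {n : ℕ∞} (x₀ : CotangentBundle d M) :
    ContMDiffAt (cotangentModel d) 𝓘(ℝ, CoModel d) n
      (fun x : CotangentBundle d M => covectorCoords x₀.proj x.proj x.snd) x₀ :=
  (((contMDiffAt_hom_bundle fun x : CotangentBundle d M => x).1
    (contMDiffAt_id (n := ∞))).2).of_le (mod_cast le_top)

/-- The Euclidean inner product as a real bilinear form; for `𝕜 = ℝ` the conjugation in the type
of `innerSL` is the identity. -/
def euclideanForm (d : ℕ) : Model d →L[ℝ] Model d →L[ℝ] ℝ :=
  innerSL ℝ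

/-- The Euclidean metric of the preferred chart at `q₀`. -/
def chartMetric (q₀ q : M) : TangentSpace (𝓡 d) q →L[ℝ] TangentSpace (𝓡 d) q →L[ℝ] ℝ :=
  letI A : Model d →L[ℝ] Model d := tangentCoords q₀ q
  (euclideanForm d).bilinearComp A A

theorem chartMetric_apply (q₀ q : M) (v w : TangentSpace (𝓡 d) q) :
    chartMetric q₀ q v w = inner ℝ (tangentCoords q₀ q v) (tangentCoords q₀ q w) := rfl

theorem chartMetric_symm (q₀ q : M) (v w : TangentSpace (𝓡 d) q) :
    chartMetric q₀ q v w = chartMetric q₀ q w v := by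
  rw [chartMetric_apply, chartMetric_apply, real_inner_comm]

theorem chartMetric_pos {q₀ q : M} (hq : q ∈ (chartAt (Model d) q₀).source)
    {v : TangentSpace (𝓡 d) q} (hv : v ≠ 0) : 0 < chartMetric q₀ q v v := by
  rw [chartMetric_apply, real_inner_self_pos]
  intro h
  rw [← tangentFrame_tangentCoords hq v, h, map_zero] at hv
  exact hv rfl

theorem bilinCoords_chartMetric {q₀ q : M} (hq : q ∈ (chartAt (Model d) q₀).source) :
    bilinCoords q₀ q (chartMetric q₀ q) = euclideanForm d := by
  ext v w
  rw [bilinCoords_apply hq, chartMetric_apply, tangentCoords_tangentFrame hq,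
    tangentCoords_tangentFrame hq]
  rfl

set_option synthInstance.maxHeartbeats 200000 in
-- Instances on the bundle of bilinear forms are slow to synthesize.
theorem contMDiffOn_chartMetric (q₀ : M) :
    ContMDiffOn (𝓡 d) ((𝓡 d).prod 𝓘(ℝ, Model d →L[ℝ] Model d →L[ℝ] ℝ)) ∞
      (fun q => TotalSpace.mk' (Model d →L[ℝ] Model d →L[ℝ] ℝ)
        (E := fun q : M => TangentSpace (𝓡 d) q →L[ℝ] TangentSpace (𝓡 d) q →L[ℝ] ℝ) q
        (chartMetric q₀ q)) (chartAt (Model d) q₀).source := by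
  let e := trivializationAt (Model d →L[ℝ] Model d →L[ℝ] ℝ)
    (fun q : M => TangentSpace (𝓡 d) q →L[ℝ] TangentSpace (𝓡 d) q →L[ℝ] ℝ) q₀
  have hsource : (chartAt (Model d) q₀).source ⊆ e.baseSet := fun q hq => ⟨hq, hq, mem_univ q⟩
  refine (e.contMDiffOn_section_iff (chartAt (Model d) q₀).open_source hsource).2 ?_
  exact (contMDiffOn_const (c := euclideanForm d)).congr fun q hq => bilinCoords_chartMetric hq

set_option synthInstance.maxHeartbeats 200000 in
-- Instances on the bundle of bilinear forms are slow to synthesize.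
theorem nonempty_smoothMetric [T2Space M] [SigmaCompactSpace M] :
    Nonempty (SmoothMetric d M) := by
  obtain ⟨g, hg⟩ := exists_contMDiffSection_forall_mem_convex_of_local (𝓡 d) (n := ⊤)
    (F_fiber := Model d →L[ℝ] Model d →L[ℝ] ℝ)
    (fun q : M => TangentSpace (𝓡 d) q →L[ℝ] TangentSpace (𝓡 d) q →L[ℝ] ℝ)
    (fun q => {B | (∀ v w, B v w = B w v) ∧ ∀ v, v ≠ 0 → 0 < B v v})
    (fun q => by exact convex_setOf_symm_posDef (V := TangentSpace (𝓡 d) q))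
    (fun q₀ => by
      exact ⟨_, chart_source_mem_nhds (Model d) q₀, chartMetric q₀, contMDiffOn_chartMetric q₀,
        fun q hq => ⟨chartMetric_symm q₀ q, fun _ => chartMetric_pos hq⟩⟩)
  exact ⟨{
    inner := g
    symm := fun q => (hg q).1
    pos := fun q => (hg q).2
    isVonNBounded := fun q => isVonNBounded_of_pos (V := Model d) (g q) (hg q).2
    contMDiff := g.contMDiff }⟩

theorem bilinCoords_pos (g : SmoothMetric d M) {q₀ q : M}
    (hq : q ∈ (chartAt (Model d) q₀).source) (v : Model d) (hv : v ≠ 0) :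
    0 < bilinCoords q₀ q (g.inner q) v v := by
  rw [bilinCoords_apply hq]
  refine g.pos q _ fun h => hv ?_
  rw [← tangentCoords_tangentFrame hq v, h, map_zero]

theorem conormSq_eq (g : SmoothMetric d M) {q₀ q : M} (hq : q ∈ (chartAt (Model d) q₀).source)
    (p : CotangentSpace d q) :
    conormSq g q p = covectorCoords q₀ q p
      (ContinuousLinearMap.inverse (bilinCoords q₀ q (g.inner q)) (covectorCoords q₀ q p)) := by
  have hsharp : bilinCoords q₀ q (g.inner q) (tangentCoords q₀ q (sharp g q p)) =
      covectorCoords q₀ q p := by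
    ext w
    rw [bilinCoords_apply hq, covectorCoords_apply hq, tangentFrame_tangentCoords hq, inner_sharp]
  rw [← hsharp, inverse_apply_of_pos _ (bilinCoords_pos g hq), hsharp, covectorCoords_apply hq,
    tangentFrame_tangentCoords hq, conormSq]

theorem contMDiff_conormSq (g : SmoothMetric d M) :
    ContMDiff (cotangentModel d) 𝓘(ℝ, ℝ) ∞
      fun x : CotangentBundle d M => conormSq g x.proj x.snd := by
  intro x₀
  have hmem : x₀.proj ∈ (chartAt (Model d) x₀.proj).source := mem_chart_source _ _
  have hproj : ContMDiffAt (cotangentModel d) (𝓡 d) ∞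
      (fun x : CotangentBundle d M => x.proj) x₀ := Bundle.contMDiffAt_proj _
  have hmetric : ContMDiffAt (𝓡 d) 𝓘(ℝ, Model d →L[ℝ] Model d →L[ℝ] ℝ) ∞
      (fun q : M => bilinCoords x₀.proj q (g.inner q)) x₀.proj :=
    ((contMDiffAt_hom_bundle _).1 g.contMDiff.contMDiffAt).2
  have hinverse := ((isInvertible_of_pos _ (bilinCoords_pos g hmem)).contDiffAt_map_inverse
    (n := ∞)).contMDiffAt
  have hp := contMDiffAt_covectorCoords (n := ⊤) x₀
  refine (hp.clm_apply
    (((hinverse.comp x₀.proj hmetric).comp x₀ hproj).clm_apply hp)).congr_of_eventuallyEq ?_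
  filter_upwards [hproj.continuousAt.eventually (chart_source_mem_nhds (Model d) x₀.proj)]
    with x hx using conormSq_eq g hx x.snd

end Metric

section Coordinates

variable {E H N : Type*} [NormedAddCommGroup E] [NormedSpace ℝ E] [TopologicalSpace H]
  {I : ModelWithCorners ℝ E H} [I.Boundaryless] [TopologicalSpace N] [ChartedSpace H N]

theorem hasFDerivAt_extChartAt_symm {f : N → ℝ} {x : N} {L : E →L[ℝ] ℝ}
    (hf : HasMFDerivAt I 𝓘(ℝ, ℝ) f x L) :
    HasFDerivAt (f ∘ (extChartAt I x).symm) L (extChartAt I x x) := by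
  have hwithin : HasFDerivWithinAt (f ∘ (extChartAt I x).symm) L (range I) (extChartAt I x x) :=
    hf.2
  rwa [I.range_eq_univ, hasFDerivWithinAt_univ] at hwithin

theorem contMDiffAt_iff_contDiffAt_extChartAt_symm {F : Type*} [NormedAddCommGroup F]
    [NormedSpace ℝ F] {f : N → F} {x : N} {n : WithTop ℕ∞} :
    ContMDiffAt I 𝓘(ℝ, F) n f x ↔
      ContDiffAt ℝ n (f ∘ (extChartAt I x).symm) (extChartAt I x x) := by
  rw [contMDiffAt_iff_source, I.range_eq_univ, contMDiffWithinAt_univ, contMDiffAt_iff_contDiffAt]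

theorem IsCkHolder.contMDiff {f : N → ℝ} {k : ℕ} {s : ℝ≥0} (hf : IsCkHolder I k s f) :
    ContMDiff I 𝓘(ℝ, ℝ) k f := by
  intro x
  obtain ⟨U, hU, hfU, -⟩ := hf x
  exact contMDiffAt_iff_contDiffAt_extChartAt_symm.2 (hfU.contDiffAt hU)

end Coordinates

section Hamiltonian

variable {d : ℕ} {M : Type*} [TopologicalSpace M] [ChartedSpace (Model d) M]
  [IsManifold (𝓡 d) ∞ M]

theorem extChartAt_cotangent (x y : CotangentBundle d M) :
    extChartAt (cotangentModel d) x y =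
      (extChartAt (𝓡 d) x.proj y.proj, covectorCoords x.proj y.proj y.snd) := by
  rw [extChartAt_coe, Function.comp_apply, hom_chart]
  rfl

theorem extChartAt_cotangent_fiber (x : CotangentBundle d M) (p : CotangentSpace d x.proj) :
    extChartAt (cotangentModel d) x ⟨x.proj, p⟩ = (extChartAt (𝓡 d) x.proj x.proj, p) := by
  rw [extChartAt_cotangent]
  refine Prod.ext rfl (ContinuousLinearMap.ext fun v => ?_)
  exact (covectorCoords_apply (mem_chart_source _ _) p v).trans
    (congrArg p (tangentFrame_self x.proj v))

theorem extChartAt_cotangent_symm_fiber (x : CotangentBundle d M) (p : CotangentSpace d x.proj) :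
    (extChartAt (cotangentModel d) x).symm (extChartAt (𝓡 d) x.proj x.proj, p) = ⟨x.proj, p⟩ := by
  refine (congrArg _ (extChartAt_cotangent_fiber x p).symm).trans
    ((extChartAt (cotangentModel d) x).left_inv ?_)
  simp [FiberBundle.chartedSpace_chartAt]

theorem extChartAt_cotangent_symm_proj (x : CotangentBundle d M) {y : Model d × CoModel d}
    (hy : y ∈ (extChartAt (cotangentModel d) x).target) :
    ((extChartAt (cotangentModel d) x).symm y).proj = (extChartAt (𝓡 d) x.proj).symm y.1 := by
  rw [FiberBundle.extChartAt_target] at hy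
  rw [FiberBundle.extChartAt, PartialEquiv.coe_trans_symm, Function.comp_apply]
  exact Trivialization.proj_symm_apply _ ((Trivialization.mem_target _).2 hy.1.2)

theorem hasMFDerivAt_proj (x : CotangentBundle d M) :
    HasMFDerivAt (cotangentModel d) (𝓡 d) (fun x : CotangentBundle d M => x.proj) x
      (ContinuousLinearMap.fst ℝ (Model d) (CoModel d)) := by
  refine ⟨(Bundle.contMDiffAt_proj (IB := 𝓡 d) (n := ∞) _).continuousAt,
    HasFDerivAt.hasFDerivWithinAt (hasFDerivAt_fst.congr_of_eventuallyEq ?_)⟩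
  filter_upwards [extChartAt_target_mem_nhds (I := cotangentModel d) x] with y hy
  rw [writtenInExtChartAt, Function.comp_apply, Function.comp_apply,
    extChartAt_cotangent_symm_proj x hy]
  rw [FiberBundle.extChartAt_target] at hy
  exact (extChartAt (𝓡 d) x.proj).right_inv hy.1.1

theorem hasDerivAt_fiber {H : CotangentBundle d M → ℝ} {x : CotangentBundle d M}
    {L : Model d × CoModel d →L[ℝ] ℝ} (hH : HasMFDerivAt (cotangentModel d) 𝓘(ℝ, ℝ) H x L)
    (ξ : CotangentSpace d x.proj) :
    HasDerivAt (fun t : ℝ => H ⟨x.proj, x.snd + t • ξ⟩) (L ((0, ξ) : Model d × CoModel d)) 0 := by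
  let p : CoModel d := x.snd
  let η : CoModel d := ξ
  have hline : HasDerivAt (fun t : ℝ => (extChartAt (𝓡 d) x.proj x.proj, p + t • η)) (0, η) 0 := by
    refine (hasDerivAt_const _ _).prodMk ?_
    simpa using ((hasDerivAt_id (0 : ℝ)).smul_const η).const_add p
  have hbase : extChartAt (cotangentModel d) x x =
      (extChartAt (𝓡 d) x.proj x.proj, p + (0 : ℝ) • η) := by
    rw [zero_smul, add_zero]
    exact extChartAt_cotangent_fiber x x.snd
  refine ((hbase ▸ hasFDerivAt_extChartAt_symm hH).comp_hasDerivAt 0 hline).congr_of_eventuallyEq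
    (Eventually.of_forall fun t => ?_)
  exact congrArg H (extChartAt_cotangent_symm_fiber x _).symm

theorem conormSq_add_smul (g : SmoothMetric d M) (q : M) (p ξ : CotangentSpace d q) (t : ℝ) :
    conormSq g q (p + t • ξ) =
      conormSq g q p + t * (2 * ξ (sharp g q p)) + t ^ 2 * conormSq g q ξ := by
  have hadd : sharp g q (p + t • ξ) = sharp g q p + t • sharp g q ξ := by
    simp only [sharp, map_add, map_smul]
  have hsymm : p (sharp g q ξ) = ξ (sharp g q p) := by
    conv_lhs => rw [← inner_sharp g q p]
    conv_rhs => rw [← inner_sharp g q ξ]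
    exact g.symm _ _ _
  simp only [conormSq, hadd, map_add, map_smul, _root_.add_apply, _root_.smul_apply, smul_eq_mul,
    hsymm]
  ring

theorem conormSq_eq_inner (g : SmoothMetric d M) (q : M) (p : CotangentSpace d q) :
    conormSq g q p = g.inner q (sharp g q p) (sharp g q p) := by
  rw [inner_sharp, conormSq]

theorem conormSq_nonneg (g : SmoothMetric d M) (q : M) (p : CotangentSpace d q) :
    0 ≤ conormSq g q p := by
  rw [conormSq_eq_inner]
  rcases eq_or_ne (sharp g q p) 0 with h | h
  · rw [h, map_zero]
  · exact (g.pos q _ h).le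

theorem eq_zero_of_conormSq_eq_zero (g : SmoothMetric d M) (q : M) {p : CotangentSpace d q}
    (hp : conormSq g q p = 0) : p = 0 := by
  rw [conormSq_eq_inner] at hp
  by_contra hne
  refine (g.pos q (sharp g q p) fun h => hne ?_).ne' hp
  rw [← inner_sharp g q p, h, map_zero]

theorem hasMFDerivAt_conormSq_zero (g : SmoothMetric d M) (q : M) :
    HasMFDerivAt (cotangentModel d) 𝓘(ℝ, ℝ)
      (fun x : CotangentBundle d M => conormSq g x.proj x.snd) ⟨q, 0⟩
      (0 : Model d × CoModel d →L[ℝ] ℝ) := by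
  let x : CotangentBundle d M := ⟨q, 0⟩
  have hderiv := ((contMDiff_conormSq g).mdifferentiable (by simp) x).hasMFDerivAt
  have hmin : IsLocalMin ((fun x : CotangentBundle d M => conormSq g x.proj x.snd) ∘
      (extChartAt (cotangentModel d) x).symm) (extChartAt (cotangentModel d) x x) := by
    refine Eventually.of_forall fun y => ?_
    have hzero : conormSq g x.proj x.snd = 0 := rfl
    rw [Function.comp_apply, Function.comp_apply, extChartAt_to_inv, hzero]
    exact conormSq_nonneg g _ _
  exact hmin.hasFDerivAt_eq_zero (hasFDerivAt_extChartAt_symm hderiv) ▸ hderiv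

theorem contMDiff_mechanicalHamiltonian (g : SmoothMetric d M) {f : M → ℝ} {n : ℕ∞}
    (hf : ContMDiff (𝓡 d) 𝓘(ℝ, ℝ) n f) :
    ContMDiff (cotangentModel d) 𝓘(ℝ, ℝ) n (mechanicalHamiltonian g f) := by
  have hkinetic : ContMDiff (cotangentModel d) 𝓘(ℝ, ℝ) n
      fun x : CotangentBundle d M => conormSq g x.proj x.snd :=
    (contMDiff_conormSq g).of_le (mod_cast le_top)
  exact (hf.comp (Bundle.contMDiff_proj _)).add (hkinetic.div_const 2)

theorem mfderiv_mechanicalHamiltonian_fiber (g : SmoothMetric d M) {f : M → ℝ}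
    (hf : ContMDiff (𝓡 d) 𝓘(ℝ, ℝ) 1 f) (x : CotangentBundle d M) (ξ : CotangentSpace d x.proj) :
    (mfderiv (cotangentModel d) 𝓘(ℝ, ℝ) (mechanicalHamiltonian g f) x :
      Model d × CoModel d →L[ℝ] ℝ) (0, ξ) = ξ (sharp g x.proj x.snd) := by
  have hH := ((contMDiff_mechanicalHamiltonian g (n := 1) hf).mdifferentiable one_ne_zero
    x).hasMFDerivAt
  refine (hasDerivAt_fiber hH ξ).unique ?_
  have hlinear := (hasDerivAt_id (0 : ℝ)).mul_const (2 * ξ (sharp g x.proj x.snd))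
  have hquadratic := (hasDerivAt_pow 2 (0 : ℝ)).mul_const (conormSq g x.proj ξ)
  have hpoly := (((hlinear.const_add (conormSq g x.proj x.snd)).add hquadratic).div_const
    2).const_add (f x.proj)
  refine (hpoly.congr_deriv (by simp)).congr_of_eventuallyEq (Eventually.of_forall fun t => ?_)
  exact congrArg (fun r => f x.proj + r / 2) (conormSq_add_smul g x.proj x.snd ξ t)

theorem hamiltonianVectorField_fst (g : SmoothMetric d M) {f : M → ℝ}
    (hf : ContMDiff (𝓡 d) 𝓘(ℝ, ℝ) 1 f) (x : CotangentBundle d M) :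
    (hamiltonianVectorField (mechanicalHamiltonian g f) x : Model d × CoModel d).1 =
      sharp g x.proj x.snd := by
  ext i
  exact mfderiv_mechanicalHamiltonian_fiber g hf x (EuclideanSpace.proj i)

theorem sum_apply_single_smul_proj (b : CoModel d) :
    ∑ i, b (EuclideanSpace.single i 1) • (EuclideanSpace.proj i : CoModel d) = b := by
  ext v
  conv_rhs => rw [← (EuclideanSpace.basisFun (Fin d) ℝ).sum_repr v]
  simp [mul_comm]

theorem mfderiv_hamiltonianVectorField (H : CotangentBundle d M → ℝ) (x : CotangentBundle d M) :
    mfderiv (cotangentModel d) 𝓘(ℝ, ℝ) H x (hamiltonianVectorField H x) = (0 : ℝ) := by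
  set L : Model d × CoModel d →L[ℝ] ℝ := mfderiv (cotangentModel d) 𝓘(ℝ, ℝ) H x
  set a : Model d := WithLp.toLp 2 fun i : Fin d => L (0, EuclideanSpace.proj i)
  set b : CoModel d := L.comp (ContinuousLinearMap.inl ℝ (Model d) (CoModel d))
  let r : CoModel d →L[ℝ] ℝ := L.comp (ContinuousLinearMap.inr ℝ (Model d) (CoModel d))
  have hra : r b = b a := by
    rw [← sum_apply_single_smul_proj b]
    simp only [map_sum, map_smul, sum_apply, smul_apply, smul_eq_mul]
    rfl
  calc L (a, -b) = L (a, 0) - L (0, b) := by rw [← map_sub]; simp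
    _ = b a - r b := rfl
    _ = 0 := by rw [hra, sub_self]

theorem hamiltonianVectorField_eq_zero (g : SmoothMetric d M) {f : M → ℝ}
    (hf : ContMDiff (𝓡 d) 𝓘(ℝ, ℝ) 1 f) {q : M} (hq : mfderiv (𝓡 d) 𝓘(ℝ, ℝ) f q = 0) :
    hamiltonianVectorField (mechanicalHamiltonian g f) (⟨q, 0⟩ : CotangentBundle d M) = 0 := by
  have hpotential : HasMFDerivAt (𝓡 d) 𝓘(ℝ, ℝ) f q (0 : Model d →L[ℝ] ℝ) :=
    hq ▸ (hf.mdifferentiable one_ne_zero q).hasMFDerivAt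
  have hsum := (HasMFDerivAt.comp (⟨q, 0⟩ : CotangentBundle d M) hpotential
    (hasMFDerivAt_proj _)).add ((hasMFDerivAt_conormSq_zero g q).const_smul (2 : ℝ)⁻¹)
  have hH : mfderiv (cotangentModel d) 𝓘(ℝ, ℝ) (mechanicalHamiltonian g f)
      (⟨q, 0⟩ : CotangentBundle d M) = (0 : Model d × CoModel d →L[ℝ] ℝ) := by
    refine (hsum.congr_of_eventuallyEq (Eventually.of_forall fun x => ?_)).mfderiv.trans ?_
    · simp [mechanicalHamiltonian, div_eq_inv_mul]
    · exact (congrArg₂ (· + ·) (ContinuousLinearMap.zero_comp _) (smul_zero _)).trans (add_zero _)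
  rw [hamiltonianVectorField, hH]
  exact Prod.ext (by ext i; rfl) (neg_eq_zero.2 (ContinuousLinearMap.zero_comp _))

end Hamiltonian

section Calculus

variable {E : Type*} [NormedAddCommGroup E] [NormedSpace ℝ E]

theorem isBigO_sub_norm_sq_of_fderiv_eq_zero {F : Type*} [NormedAddCommGroup F] [NormedSpace ℝ F]
    {f : E → F} {x : E} (hf : ContDiffAt ℝ 2 f x) (hx : fderiv ℝ f x = 0) :
    (fun y => f y - f x) =O[𝓝 x] fun y => ‖y - x‖ ^ 2 := by
  have hfderiv : ContDiffAt ℝ 1 (fderiv ℝ f) x := hf.fderiv_right (by norm_num)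
  obtain ⟨K, t, ht, hK⟩ := hfderiv.exists_lipschitzOnWith
  have hdiff : ∀ᶠ y in 𝓝 x, DifferentiableAt ℝ f y :=
    (hf.eventually (by simp)).mono fun y hy => hy.differentiableAt (by simp)
  obtain ⟨r, hr, hball⟩ := Metric.mem_nhds_iff.1 (inter_mem ht hdiff)
  refine Asymptotics.IsBigO.of_bound K ?_
  filter_upwards [Metric.ball_mem_nhds x hr] with y hy
  have hsub : Metric.closedBall x ‖y - x‖ ⊆ Metric.ball x r :=
    Metric.closedBall_subset_ball (by rwa [← dist_eq_norm])
  have hbound : ∀ z ∈ Metric.closedBall x ‖y - x‖, ‖fderiv ℝ f z‖ ≤ K * ‖y - x‖ := by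
    intro z hz
    have hlip := hK.dist_le_mul z (hball (hsub hz)).1 x (mem_of_mem_nhds ht)
    rw [hx, dist_zero_right] at hlip
    exact hlip.trans (mul_le_mul_of_nonneg_left (Metric.mem_closedBall.1 hz) K.coe_nonneg)
  calc ‖f y - f x‖ ≤ K * ‖y - x‖ * ‖y - x‖ :=
        (convex_closedBall x ‖y - x‖).norm_image_sub_le_of_norm_fderiv_le
          (fun z hz => (hball (hsub hz)).2) hbound
          (Metric.mem_closedBall_self (norm_nonneg _)) (by simp [dist_eq_norm])
    _ = K * ‖‖y - x‖ ^ 2‖ := by rw [norm_pow, norm_norm]; ring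

theorem eventually_nhdsGE_eq_zero_of_norm_deriv_le {u u' : ℝ → E} {t₀ K : ℝ} (h0 : u t₀ = 0)
    (h : ∀ᶠ t in 𝓝 t₀, HasDerivAt u (u' t) t ∧ ‖u' t‖ ≤ K * ‖u t‖) :
    ∀ᶠ t in 𝓝[≥] t₀, u t = 0 := by
  obtain ⟨l, r, ht₀, hlr⟩ := mem_nhds_iff_exists_Ioo_subset.1 h
  obtain ⟨b, hb₀, hbr⟩ := exists_between ht₀.2
  have hsub : ∀ t ∈ Icc t₀ b, HasDerivAt u (u' t) t ∧ ‖u' t‖ ≤ K * ‖u t‖ := fun t ht =>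
    hlr ⟨ht₀.1.trans_le ht.1, ht.2.trans_lt hbr⟩
  filter_upwards [Icc_mem_nhdsGE hb₀]
  exact eq_zero_of_abs_deriv_le_mul_abs_self_of_eq_zero_right (K := K) (f' := u')
    (fun t ht => (hsub t ht).1.continuousAt.continuousWithinAt)
    (fun t ht => (hsub t (Ico_subset_Icc_self ht)).1.hasDerivWithinAt) h0
    (fun t ht => (hsub t (Ico_subset_Icc_self ht)).2)

theorem eventually_eq_zero_of_norm_deriv_le {u u' : ℝ → E} {t₀ K : ℝ} (h0 : u t₀ = 0)
    (h : ∀ᶠ t in 𝓝 t₀, HasDerivAt u (u' t) t ∧ ‖u' t‖ ≤ K * ‖u t‖) : ∀ᶠ t in 𝓝 t₀, u t = 0 := by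
  have hneg : ∀ᶠ t in 𝓝 (-t₀), HasDerivAt (fun t => u (-t)) (-u' (-t)) t ∧
      ‖-u' (-t)‖ ≤ K * ‖u (-t)‖ := by
    have hback : Tendsto Neg.neg (𝓝 (-t₀)) (𝓝 t₀) := by simpa using tendsto_neg (-t₀)
    filter_upwards [hback.eventually h] with t ht
    refine ⟨?_, by simpa only [norm_neg] using ht.2⟩
    have hchain := ht.1.scomp t (hasDerivAt_neg t)
    rw [neg_one_smul] at hchain
    exact hchain
  have hleft : ∀ᶠ t in 𝓝[≤] t₀, u t = 0 := by
    filter_upwards [tendsto_neg_nhdsLE.eventually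
      (eventually_nhdsGE_eq_zero_of_norm_deriv_le (by rwa [neg_neg]) hneg)] with t ht
    rwa [neg_neg] at ht
  rw [← nhdsLE_sup_nhdsGE]
  exact Filter.eventually_sup.2 ⟨hleft, eventually_nhdsGE_eq_zero_of_norm_deriv_le h0 h⟩

end Calculus

section Dynamics

variable {d : ℕ} {M : Type*} [TopologicalSpace M] [ChartedSpace (Model d) M]
  [IsManifold (𝓡 d) ∞ M]

/-- The part `{(q, 0) : q ∈ Λ₀}` of the zero section of `T^*M` that lies over `Λ₀`; it consists of
equilibria when `Λ₀` consists of critical points of the potential. -/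
def zeroSectionOver (Λ₀ : Set M) : Set (CotangentBundle d M) :=
  {x | x.proj ∈ Λ₀ ∧ x.snd = 0}

theorem zeroSectionOver_eq_image (Λ₀ : Set M) : (zeroSectionOver Λ₀ : Set (CotangentBundle d M)) =
    zeroSection (CoModel d) (fun q : M => TangentSpace (𝓡 d) q →L[ℝ] ℝ) '' Λ₀ := by
  ext ⟨q, p⟩
  constructor
  · rintro ⟨hq, rfl : p = 0⟩
    exact ⟨q, hq, rfl⟩
  · rintro ⟨q', hq', h⟩
    rw [← h]
    exact ⟨hq', rfl⟩

theorem proj_image_zeroSectionOver (Λ₀ : Set M) :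
    TotalSpace.proj '' (zeroSectionOver Λ₀ : Set (CotangentBundle d M)) = Λ₀ := by
  rw [zeroSectionOver_eq_image, image_image]
  exact image_id' Λ₀

theorem continuous_zeroSection_cotangent :
    Continuous (zeroSection (CoModel d) (fun q : M => TangentSpace (𝓡 d) q →L[ℝ] ℝ)) :=
  (contMDiff_zeroSection ℝ (fun q : M => TangentSpace (𝓡 d) q →L[ℝ] ℝ) (IB := 𝓡 d)
    (n := ∞)).continuous

theorem isCompact_zeroSectionOver {Λ₀ : Set M} (hΛ : IsCompact Λ₀) :
    IsCompact (zeroSectionOver Λ₀ : Set (CotangentBundle d M)) :=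
  zeroSectionOver_eq_image (d := d) Λ₀ ▸ hΛ.image continuous_zeroSection_cotangent

theorem isConnected_zeroSectionOver {Λ₀ : Set M} (hΛ : IsConnected Λ₀) :
    IsConnected (zeroSectionOver Λ₀ : Set (CotangentBundle d M)) :=
  zeroSectionOver_eq_image (d := d) Λ₀ ▸ hΛ.image _ continuous_zeroSection_cotangent.continuousOn

theorem isInvariant_mechanicalHamiltonian (g : SmoothMetric d M) {f : M → ℝ}
    (hf : ContMDiff (𝓡 d) 𝓘(ℝ, ℝ) 1 f) {Λ₀ : Set M}
    (hΛ : ∀ q ∈ Λ₀, mfderiv (𝓡 d) 𝓘(ℝ, ℝ) f q = 0) :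
    IsInvariant (mechanicalHamiltonian g f) (zeroSectionOver Λ₀) := by
  rintro ⟨q, p⟩ ⟨hq, hp⟩
  obtain rfl : p = 0 := hp
  exact ⟨fun _ => ⟨q, 0⟩, rfl,
    isMIntegralCurve_const (hamiltonianVectorField_eq_zero g hf (hΛ q hq)), fun _ => ⟨hq, rfl⟩⟩

theorem exists_norm_sq_mfderiv_extChartAt_le (g : SmoothMetric d M) (q₀ : M) :
    ∃ C : ℝ, 0 ≤ C ∧ ∀ᶠ q in 𝓝 q₀, ∀ v : TangentSpace (𝓡 d) q,
      ‖(show Model d from mfderiv (𝓡 d) 𝓘(ℝ, Model d) (extChartAt (𝓡 d) q₀) q v)‖ ^ 2 ≤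
        C * g.inner q v v := by
  let : RiemannianBundle (fun q : M => TangentSpace (𝓡 d) q) := ⟨g.toRiemannianMetric⟩
  have : IsContinuousRiemannianBundle (Model d) (fun q : M => TangentSpace (𝓡 d) q) :=
    ⟨⟨g.inner, g.contMDiff.continuous, fun _ _ _ => rfl⟩⟩
  obtain ⟨C, hC, hev⟩ := eventually_norm_trivializationAt_lt (Model d)
    (fun q : M => TangentSpace (𝓡 d) q) q₀
  refine ⟨C ^ 2, by positivity, ?_⟩
  filter_upwards [hev, chart_source_mem_nhds (Model d) q₀] with q hq hqs v
  have hinner : g.inner q v v = ‖v‖ ^ 2 := real_inner_self_eq_norm_sq v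
  rw [← TangentBundle.continuousLinearMapAt_trivializationAt hqs, hinner, ← mul_pow]
  exact pow_le_pow_left₀ (norm_nonneg _) (ContinuousLinearMap.le_of_opNorm_le _ hq.le v) 2

omit [IsManifold (𝓡 d) ∞ M] in
theorem isBigO_sub_of_mfderiv_eq_zero {f : M → ℝ} {q₀ : M}
    (hf : ContMDiffAt (𝓡 d) 𝓘(ℝ, ℝ) 2 f q₀) (hq₀ : mfderiv (𝓡 d) 𝓘(ℝ, ℝ) f q₀ = 0) :
    (fun q => f q - f q₀) =O[𝓝 q₀]
      fun q => ‖extChartAt (𝓡 d) q₀ q - extChartAt (𝓡 d) q₀ q₀‖ ^ 2 := by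
  have hcritical : HasMFDerivAt (𝓡 d) 𝓘(ℝ, ℝ) f q₀ (0 : Model d →L[ℝ] ℝ) :=
    hq₀ ▸ (hf.mdifferentiableAt two_ne_zero).hasMFDerivAt
  refine ((isBigO_sub_norm_sq_of_fderiv_eq_zero
    (contMDiffAt_iff_contDiffAt_extChartAt_symm.1 hf)
    (hasFDerivAt_extChartAt_symm hcritical).fderiv).comp_tendsto
    (continuousAt_extChartAt (I := 𝓡 d) q₀)).congr' ?_ EventuallyEq.rfl
  filter_upwards [extChartAt_source_mem_nhds (I := 𝓡 d) q₀] with q hq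
  simp only [Function.comp_apply, (extChartAt (𝓡 d) q₀).left_inv hq, extChartAt_to_inv]

section IntegralCurve

theorem hamiltonian_eq_of_isMIntegralCurveOn {H : CotangentBundle d M → ℝ}
    (hH : ContMDiff (cotangentModel d) 𝓘(ℝ, ℝ) 1 H) {γ : ℝ → CotangentBundle d M} {a b : ℝ}
    (hγ : IsMIntegralCurveOn (I := cotangentModel d) γ (hamiltonianVectorField H) (Ioo a b))
    {t t' : ℝ} (ht : t ∈ Ioo a b) (ht' : t' ∈ Ioo a b) : H (γ t) = H (γ t') := by
  have hderiv : ∀ t ∈ Ioo a b, HasDerivAt (H ∘ γ) 0 t := by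
    intro t ht
    have hchain : HasFDerivAt (H ∘ γ) ((show Model d × CoModel d →L[ℝ] ℝ from
        mfderiv (cotangentModel d) 𝓘(ℝ, ℝ) H (γ t)).comp ((1 : ℝ →L[ℝ] ℝ).smulRight
        (show Model d × CoModel d from hamiltonianVectorField H (γ t)))) t :=
      hasMFDerivAt_iff_hasFDerivAt.1 <| HasMFDerivAt.comp t
        (hH.mdifferentiable one_ne_zero (γ t)).hasMFDerivAt
        ((hγ t ht).hasMFDerivAt (Ioo_mem_nhds ht.1 ht.2))
    refine hchain.hasDerivAt.congr_deriv (Eq.trans ?_ (mfderiv_hamiltonianVectorField H (γ t)))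
    exact congrArg (mfderiv (cotangentModel d) 𝓘(ℝ, ℝ) H (γ t)) (one_smul ℝ _)
  exact isOpen_Ioo.is_const_of_deriv_eq_zero (f := H ∘ γ) isPreconnected_Ioo
    (fun t ht => (hderiv t ht).differentiableAt.differentiableWithinAt)
    (fun t ht => (hderiv t ht).deriv) ht ht'

variable {g : SmoothMetric d M} {f : M → ℝ} {γ : ℝ → CotangentBundle d M} {a b t : ℝ}
  (hf : ContMDiff (𝓡 d) 𝓘(ℝ, ℝ) 1 f)
  (hγ : IsMIntegralCurveOn (I := cotangentModel d) γ
    (hamiltonianVectorField (mechanicalHamiltonian g f)) (Ioo a b))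
  (ht : t ∈ Ioo a b)

include hγ ht in
theorem continuousAt_proj_of_isMIntegralCurveOn : ContinuousAt (fun t => (γ t).proj) t :=
  (hasMFDerivAt_proj (γ t)).continuousAt.comp
    ((hγ t ht).hasMFDerivAt (Ioo_mem_nhds ht.1 ht.2)).continuousAt

include hf hγ ht

theorem hasDerivAt_extChartAt_proj {q₀ : M} (hq : (γ t).proj ∈ (chartAt (Model d) q₀).source) :
    HasDerivAt (fun t => extChartAt (𝓡 d) q₀ (γ t).proj)
      (show Model d from mfderiv (𝓡 d) 𝓘(ℝ, Model d) (extChartAt (𝓡 d) q₀) (γ t).proj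
        (sharp g (γ t).proj (γ t).snd)) t := by
  have hchart := ((contMDiffAt_extChartAt' (I := 𝓡 d) (n := 1) hq).mdifferentiableAt
    one_ne_zero).hasMFDerivAt
  have hchain : HasFDerivAt (fun t => extChartAt (𝓡 d) q₀ (γ t).proj)
      ((show Model d →L[ℝ] Model d from
        mfderiv (𝓡 d) 𝓘(ℝ, Model d) (extChartAt (𝓡 d) q₀) (γ t).proj).comp
        ((ContinuousLinearMap.fst ℝ (Model d) (CoModel d)).comp ((1 : ℝ →L[ℝ] ℝ).smulRight
          (show Model d × CoModel d from
            hamiltonianVectorField (mechanicalHamiltonian g f) (γ t))))) t :=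
    hasMFDerivAt_iff_hasFDerivAt.1 <| HasMFDerivAt.comp t hchart <|
      HasMFDerivAt.comp t (hasMFDerivAt_proj (γ t))
        ((hγ t ht).hasMFDerivAt (Ioo_mem_nhds ht.1 ht.2))
  refine hchain.hasDerivAt.congr_deriv ?_
  refine congrArg (mfderiv (𝓡 d) 𝓘(ℝ, Model d) (extChartAt (𝓡 d) q₀) (γ t).proj) ?_
  exact (congrArg Prod.fst (one_smul ℝ _)).trans (hamiltonianVectorField_fst g hf (γ t))

theorem conormSq_eq_of_isMIntegralCurveOn {t₀ : ℝ} (ht₀ : t₀ ∈ Ioo a b) (hp₀ : (γ t₀).snd = 0) :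
    conormSq g (γ t).proj (γ t).snd = 2 * (f (γ t₀).proj - f (γ t).proj) := by
  have henergy := hamiltonian_eq_of_isMIntegralCurveOn
    (contMDiff_mechanicalHamiltonian g (n := 1) hf) hγ ht ht₀
  have hrest : conormSq g (γ t₀).proj (γ t₀).snd = 0 := by
    rw [hp₀]
    rfl
  rw [mechanicalHamiltonian, mechanicalHamiltonian, hrest] at henergy
  linarith

end IntegralCurve

/-- Conservation of energy bounds the speed near the critical point by the distance to it, so that
Grönwall's inequality applies. -/
theorem eventually_proj_eq_of_isMIntegralCurveOn {g : SmoothMetric d M} {f : M → ℝ}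
    (hf : ContMDiff (𝓡 d) 𝓘(ℝ, ℝ) 2 f) {γ : ℝ → CotangentBundle d M} {a b : ℝ}
    (hγ : IsMIntegralCurveOn (I := cotangentModel d) γ
      (hamiltonianVectorField (mechanicalHamiltonian g f)) (Ioo a b))
    {t₀ : ℝ} (ht₀ : t₀ ∈ Ioo a b) (hq₀ : mfderiv (𝓡 d) 𝓘(ℝ, ℝ) f (γ t₀).proj = 0)
    (hp₀ : (γ t₀).snd = 0) {t₁ : ℝ} (ht₁ : t₁ ∈ Ioo a b) (hqt₁ : (γ t₁).proj = (γ t₀).proj) :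
    ∀ᶠ t in 𝓝 t₁, (γ t).proj = (γ t₀).proj := by
  have hf1 : ContMDiff (𝓡 d) 𝓘(ℝ, ℝ) 1 f := hf.of_le one_le_two
  set q₀ := (γ t₀).proj with hq₀_def
  obtain ⟨C, hC, hspeed⟩ := exists_norm_sq_mfderiv_extChartAt_le g q₀
  obtain ⟨C', hC', hpotential⟩ := (isBigO_sub_of_mfderiv_eq_zero (hf q₀) hq₀).exists_nonneg
  have hnear : Tendsto (fun t => (γ t).proj) (𝓝 t₁) (𝓝 q₀) := by
    simpa only [ContinuousAt, hqt₁] using continuousAt_proj_of_isMIntegralCurveOn hγ ht₁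
  have hsource := hnear.eventually (chart_source_mem_nhds (Model d) q₀)
  have hgronwall : ∀ᶠ t in 𝓝 t₁,
      HasDerivAt (fun t => extChartAt (𝓡 d) q₀ (γ t).proj - extChartAt (𝓡 d) q₀ q₀)
        (show Model d from mfderiv (𝓡 d) 𝓘(ℝ, Model d) (extChartAt (𝓡 d) q₀) (γ t).proj
          (sharp g (γ t).proj (γ t).snd)) t ∧
      ‖(show Model d from mfderiv (𝓡 d) 𝓘(ℝ, Model d) (extChartAt (𝓡 d) q₀) (γ t).proj
          (sharp g (γ t).proj (γ t).snd))‖ ≤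
        √(2 * C * C') * ‖extChartAt (𝓡 d) q₀ (γ t).proj - extChartAt (𝓡 d) q₀ q₀‖ := by
    filter_upwards [Ioo_mem_nhds ht₁.1 ht₁.2, hnear.eventually hpotential.bound, hsource,
      hnear.eventually hspeed] with t ht hpot hts hsp
    refine ⟨(hasDerivAt_extChartAt_proj hf1 hγ ht hts).sub_const _, ?_⟩
    refine abs_le_of_sq_le_sq' ?_ (by positivity) |>.2
    rw [norm_pow, norm_norm, norm_sub_rev, Real.norm_eq_abs] at hpot
    specialize hsp (sharp g (γ t).proj (γ t).snd)
    rw [← conormSq_eq_inner, conormSq_eq_of_isMIntegralCurveOn hf1 hγ ht ht₀ hp₀,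
      ← hq₀_def] at hsp
    rw [mul_pow, Real.sq_sqrt (by positivity)]
    linarith [mul_le_mul_of_nonneg_left ((le_abs_self _).trans hpot) hC]
  have hzero := eventually_eq_zero_of_norm_deriv_le (by simp only [hqt₁, sub_self]) hgronwall
  filter_upwards [hsource, hzero] with t hts htz
  exact (extChartAt (𝓡 d) q₀).injOn (by rwa [extChartAt_source]) (mem_extChartAt_source _)
    (sub_eq_zero.1 htz)

theorem containsItsOrbits_mechanicalHamiltonian [T2Space M] (g : SmoothMetric d M) {f : M → ℝ}
    (hf : ContMDiff (𝓡 d) 𝓘(ℝ, ℝ) 2 f) {Λ₀ : Set M}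
    (hΛ : ∀ q ∈ Λ₀, mfderiv (𝓡 d) 𝓘(ℝ, ℝ) f q = 0) :
    ContainsItsOrbits (mechanicalHamiltonian g f) (zeroSectionOver Λ₀) := by
  rintro γ a b hγ t₀ ht₀ ⟨hq₀, hp₀⟩ t ht
  have hconst : Ioo a b ⊆ {t | t ∈ Ioo a b ∧ (γ t).proj = (γ t₀).proj} := by
    refine isPreconnected_Ioo.subset_of_closure_inter_subset ?_ ⟨t₀, ht₀, ht₀, rfl⟩ ?_
    · refine isOpen_iff_mem_nhds.2 fun t₁ ⟨ht₁, hqt₁⟩ => ?_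
      filter_upwards [Ioo_mem_nhds ht₁.1 ht₁.2,
        eventually_proj_eq_of_isMIntegralCurveOn hf hγ ht₀ (hΛ _ hq₀) hp₀ ht₁ hqt₁]
        with t ht hqt using ⟨ht, hqt⟩
    · rintro t ⟨htc, ht⟩
      have hfreq : ∃ᶠ t' in 𝓝 t, (γ t').proj = (γ t₀).proj :=
        (mem_closure_iff_frequently.1 htc).mono fun _ h => h.2
      exact ⟨ht, tendsto_nhds_unique_of_frequently_eq
        (continuousAt_proj_of_isMIntegralCurveOn hγ ht) tendsto_const_nhds hfreq⟩
  have hqt : (γ t).proj = (γ t₀).proj := (hconst ht).2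
  refine ⟨hqt ▸ hq₀, eq_zero_of_conormSq_eq_zero g _ ?_⟩
  rw [conormSq_eq_of_isMIntegralCurveOn (hf.of_le one_le_two) hγ ht ht₀ hp₀, hqt, sub_self,
    mul_zero]

end Dynamics

section Transplant

section IndicatorComp

variable {X Y Z : Type*} [TopologicalSpace X] [TopologicalSpace Y] [Zero Z]
  {e : OpenPartialHomeomorph X Y} {F : Y → Z} {x : X}

theorem indicator_comp_eventuallyEq (hx : x ∈ e.source) :
    e.source.indicator (F ∘ e) =ᶠ[𝓝 x] F ∘ e :=
  eqOn_indicator.eventuallyEq_of_mem (e.open_source.mem_nhds hx)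

theorem indicator_comp_eventuallyEq_zero [T2Space X] (he : e.target = univ)
    (hF : HasCompactSupport F) (hx : x ∉ e.source) :
    e.source.indicator (F ∘ e) =ᶠ[𝓝 x] 0 := by
  have hclosed : IsClosed (e.symm '' tsupport F) :=
    (hF.isCompact.image_of_continuousOn (e.continuousOn_symm.mono (he ▸ subset_univ _))).isClosed
  have hsub : e.symm '' tsupport F ⊆ e.source := by
    rintro _ ⟨y, -, rfl⟩
    exact e.map_target (he ▸ mem_univ y)
  filter_upwards [hclosed.isOpen_compl.mem_nhds fun h => hx (hsub h)] with x' hx'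
  refine indicator_apply_eq_zero.2 fun hxe => ?_
  exact image_eq_zero_of_notMem_tsupport (f := F) fun h => hx' ⟨_, h, e.left_inv hxe⟩

end IndicatorComp

variable {d : ℕ} {M : Type*} [TopologicalSpace M] [ChartedSpace (Model d) M]

theorem exists_openPartialHomeomorph_target_eq_univ [IsManifold (𝓡 d) ∞ M] [Nonempty M] :
    ∃ e : OpenPartialHomeomorph M (Model d),
      e.target = univ ∧ ContMDiffOn (𝓡 d) 𝓘(ℝ, Model d) ∞ e e.source := by
  obtain ⟨q₀⟩ := ‹Nonempty M›
  obtain ⟨r, hr, hball⟩ := Metric.mem_nhds_iff.1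
    (chart_target_mem_nhds (Model d) q₀)
  set b := OpenPartialHomeomorph.univBall (chartAt (Model d) q₀ q₀) r
  have hbtarget : b.target = Metric.ball (chartAt (Model d) q₀ q₀) r :=
    OpenPartialHomeomorph.univBall_target _ hr
  refine ⟨(chartAt (Model d) q₀).trans b.symm, ?_, ?_⟩
  · rw [OpenPartialHomeomorph.trans_target, OpenPartialHomeomorph.symm_target,
      OpenPartialHomeomorph.symm_symm, OpenPartialHomeomorph.univBall_source, univ_inter,
      eq_univ_iff_forall]
    exact fun y => hball (hbtarget ▸ b.map_source (by simp [b]))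
  · rw [OpenPartialHomeomorph.trans_source]
    exact OpenPartialHomeomorph.contDiffOn_univBall_symm.contMDiffOn.comp
      (contMDiffOn_chart.mono inter_subset_left) fun q hq => hbtarget ▸ hq.2

variable {e : OpenPartialHomeomorph M (Model d)} {F : Model d → ℝ}

theorem isCkHolder_indicator_comp [T2Space M] (he : e.target = univ)
    (hesmooth : ContMDiffOn (𝓡 d) 𝓘(ℝ, Model d) ∞ e e.source) (hFsupp : HasCompactSupport F)
    {k : ℕ} {s : ℝ≥0} (hs : s ≤ 1) (hF : ∀ y, CkHolderAt k s F y) :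
    IsCkHolder (𝓡 d) k s (e.source.indicator (F ∘ e)) := by
  intro q
  have hsymm : Tendsto (extChartAt (𝓡 d) q).symm (𝓝 (extChartAt (𝓡 d) q q)) (𝓝 q) := by
    simpa only [ContinuousAt, extChartAt_to_inv] using continuousAt_extChartAt_symm (I := 𝓡 d) q
  by_cases hq : q ∈ e.source
  · have hchart : ContDiffAt ℝ (k + 1 : ℕ) (e ∘ (extChartAt (𝓡 d) q).symm)
        (extChartAt (𝓡 d) q q) :=
      contMDiffAt_iff_contDiffAt_extChartAt_symm.1 <|
        (hesmooth.contMDiffAt (e.open_source.mem_nhds hq)).of_le (by exact_mod_cast le_top)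
    exact ((hF _).comp_contDiffAt hs hchart).congr <|
      hsymm.eventually (indicator_comp_eventuallyEq hq)
  · have hzero : ContDiffAt ℝ (k + 1 : ℕ) (0 : Model d → ℝ) (extChartAt (𝓡 d) q q) :=
      contDiffAt_const
    exact (CkHolderAt.of_contDiffAt hs hzero).congr <|
      hsymm.eventually (indicator_comp_eventuallyEq_zero he hFsupp hq)

theorem mfderiv_indicator_comp_eq_zero (hesmooth : ContMDiffOn (𝓡 d) 𝓘(ℝ, Model d) ∞ e e.source)
    {q : M} (hq : q ∈ e.source) (hF : HasFDerivAt F (0 : Model d →L[ℝ] ℝ) (e q)) :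
    mfderiv (𝓡 d) 𝓘(ℝ, ℝ) (e.source.indicator (F ∘ e)) q = 0 := by
  have hediff := ((hesmooth.contMDiffAt (e.open_source.mem_nhds hq)).mdifferentiableAt
    (by simp)).hasMFDerivAt
  rw [(indicator_comp_eventuallyEq hq).mfderiv_eq]
  exact (HasMFDerivAt.comp (I' := 𝓘(ℝ, Model d)) q hF.hasMFDerivAt hediff).mfderiv.trans
    (ContinuousLinearMap.zero_comp _)

theorem exists_isWhitneyNorton [IsManifold (𝓡 d) ∞ M] [T2Space M] [Nonempty M] (hd : 2 ≤ d)
    {β : ℝ} (hβ : 1 ≤ β) (hβd : β < d) :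
    ∃ (f : M → ℝ) (Λ₀ : Set M), IsWhitneyNorton d f Λ₀ ∧
      ∀ (k : ℕ) (s : ℝ≥0), s ≤ 1 → k + s ≤ β → IsCkHolder (𝓡 d) k s f := by
  obtain ⟨K, F, hK, hKconn, hFsupp, hF, hcrit, x, hx, y, hy, hxy⟩ := exists_whitney_function hd hβd
  obtain ⟨e, he, hesmooth⟩ := exists_openPartialHomeomorph_target_eq_univ (d := d) (M := M)
  have htarget : ∀ z, z ∈ e.target := fun z => he ▸ mem_univ z
  have hsymm : ContinuousOn e.symm K := e.continuousOn_symm.mono fun z _ => htarget z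
  have hf : ∀ (k : ℕ) (s : ℝ≥0), s ≤ 1 → k + s ≤ β →
      IsCkHolder (𝓡 d) k s (e.source.indicator (F ∘ e)) := fun k s hs hks =>
    isCkHolder_indicator_comp he hesmooth hFsupp hs (hF k s hs hks)
  have hvalue : ∀ z, e.source.indicator (F ∘ e) (e.symm z) = F z := fun z => by
    rw [indicator_of_mem (e.map_target (htarget z)), Function.comp_apply, e.right_inv (htarget z)]
  have hFdiff : ∀ z, DifferentiableAt ℝ F z := fun z =>
    (hF 1 0 zero_le_one (by simpa using hβ) z).contDiffAt.differentiableAt (by simp)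
  refine ⟨e.source.indicator (F ∘ e), e.symm '' K, ⟨?_, hK.image_of_continuousOn hsymm,
    hKconn.image _ hsymm, ?_, _, ⟨x, hx, rfl⟩, _, ⟨y, hy, rfl⟩, ?_⟩, hf⟩
  · exact_mod_cast (hf 1 0 zero_le_one (by simpa using hβ)).contMDiff
  · rintro _ ⟨z, hz, rfl⟩
    refine mfderiv_indicator_comp_eq_zero hesmooth (e.map_target (htarget z)) ?_
    rw [e.right_inv (htarget z), ← hcrit z hz]
    exact (hFdiff z).hasFDerivAt
  · rwa [hvalue, hvalue]

theorem isCkHolder_mechanicalHamiltonian [IsManifold (𝓡 d) ∞ M] (g : SmoothMetric d M) {f : M → ℝ}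
    {k : ℕ} {s : ℝ≥0} (hs : s ≤ 1) (hf : IsCkHolder (𝓡 d) k s f) :
    IsCkHolder (cotangentModel d) k s (mechanicalHamiltonian g f) := by
  intro x
  have hpotential : CkHolderAt k s ((f ∘ (extChartAt (𝓡 d) x.proj).symm) ∘ Prod.fst)
      (extChartAt (cotangentModel d) x x) := by
    refine CkHolderAt.comp_contDiffAt hs ?_ contDiffAt_fst
    rw [extChartAt_cotangent]
    exact hf x.proj
  have hkinetic : ContDiffAt ℝ (k + 1 : ℕ)
      ((fun x : CotangentBundle d M => conormSq g x.proj x.snd / 2) ∘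
        (extChartAt (cotangentModel d) x).symm) (extChartAt (cotangentModel d) x x) :=
    (contMDiffAt_iff_contDiffAt_extChartAt_symm.1
      ((contMDiff_conormSq g x).of_le (by exact_mod_cast le_top))).div_const 2
  refine (hpotential.add (.of_contDiffAt hs hkinetic)).congr ?_
  filter_upwards [extChartAt_target_mem_nhds (I := cotangentModel d) x] with y hy
  simp only [Function.comp_apply, mechanicalHamiltonian, extChartAt_cotangent_symm_proj x hy]

theorem mechanicalHamiltonian_zero [IsManifold (𝓡 d) ∞ M] (g : SmoothMetric d M) (f : M → ℝ)
    (q : M) : mechanicalHamiltonian g f ⟨q, 0⟩ = f q := by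
  simp only [mechanicalHamiltonian, conormSq, zero_apply, zero_div, add_zero]

theorem isLagrangianGraph_zero : IsLagrangianGraph fun q : M => (0 : CotangentSpace d q) := fun q =>
  ⟨univ, isOpen_univ, mem_univ q, 0, contMDiffOn_const, fun _ _ => mfderiv_const.symm⟩

end Transplant

theorem natCast_add_lt_of_admissible {d d' : ℕ} {s : ℝ≥0}
    (hs : (d' + 1 < d ∧ s ≤ 1) ∨ (d' + 1 = d ∧ s < 1)) : (d' : ℝ) + s < d := by
  rcases hs with ⟨hd', hs⟩ | ⟨rfl, hs⟩
  · have hd'R : (d' : ℝ) + 1 < d := by exact_mod_cast hd'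
    linarith [NNReal.coe_le_one.2 hs]
  · push_cast
    linarith [NNReal.coe_lt_one.2 hs]

end LagrangianGraphs

end

open LagrangianGraphs in
theorem theorem3_general (d : ℕ) (hd : 2 ≤ d)
    (M : Type*) [TopologicalSpace M] [T2Space M] [Nonempty M]
    [ChartedSpace (EuclideanSpace ℝ (Fin d)) M] [IsManifold (𝓡 d) ∞ M]
    (g : SmoothMetric d M)
    (d' : ℕ) (s : ℝ≥0) (hs : (d' + 1 < d ∧ s ≤ 1) ∨ (d' + 1 = d ∧ s < 1)) :
    ∃ (H : CotangentBundle d M → ℝ)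
      (Γ : (q : M) → CotangentSpace d q)
      (Λ : Set (CotangentBundle d M)),
      IsCkHolder (cotangentModel d) d' s H ∧
      ContMDiff (cotangentModel d) 𝓘(ℝ, ℝ) 1 H ∧
      IsLagrangianGraph Γ ∧
      IsCompact Λ ∧ IsConnected Λ ∧ Λ ⊆ graph Γ ∧
      IsInvariant H Λ ∧
      (3 ≤ d → ContainsItsOrbits H Λ) ∧
      (∃ x ∈ Λ, ∃ y ∈ Λ, H x ≠ H y) ∧
      (∀ q, Γ q = 0) ∧
      ∃ f : M → ℝ,
        IsCkHolder (𝓡 d) d' s f ∧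
        IsWhitneyNorton d f (TotalSpace.proj '' Λ) ∧
        ∀ x, H x = mechanicalHamiltonian g f x := by
  have hs1 : s ≤ 1 := hs.elim And.right fun h => h.2.le
  have hd1 : (1 : ℝ) ≤ d - 1 := by
    have : (2 : ℝ) ≤ d := by exact_mod_cast hd
    linarith
  obtain ⟨f, Λ₀, hfΛ, hf⟩ := exists_isWhitneyNorton (M := M) hd
    (le_max_of_le_right hd1)
    (max_lt (natCast_add_lt_of_admissible hs) (sub_one_lt (d : ℝ)))
  have hfd : IsCkHolder (𝓡 d) d' s f := hf d' s hs1 (le_max_left _ _)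
  refine ⟨mechanicalHamiltonian g f, fun _ => 0, zeroSectionOver Λ₀,
    isCkHolder_mechanicalHamiltonian g hs1 hfd,
    contMDiff_mechanicalHamiltonian g (n := 1) hfΛ.contMDiff,
    isLagrangianGraph_zero, isCompact_zeroSectionOver hfΛ.isCompact,
    isConnected_zeroSectionOver hfΛ.isConnected, fun _ hx => hx.2,
    isInvariant_mechanicalHamiltonian g hfΛ.contMDiff hfΛ.critical,
    fun hd3 => containsItsOrbits_mechanicalHamiltonian g ?_ hfΛ.critical, ?_,
    fun _ => rfl, f, hfd, ?_, fun _ => rfl⟩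
  · have hpred : ((d - 1 : ℕ) : ℝ) = d - 1 := Nat.cast_pred (by omega)
    refine (hf (d - 1) 0 zero_le_one ?_).contMDiff.of_le ?_
    · rw [NNReal.coe_zero, add_zero, hpred]
      exact le_max_right _ _
    · exact_mod_cast (by omega : 2 ≤ d - 1)
  · obtain ⟨q₁, hq₁, q₂, hq₂, hne⟩ := hfΛ.not_constant
    refine ⟨⟨q₁, 0⟩, ⟨hq₁, rfl⟩, ⟨q₂, 0⟩, ⟨hq₂, rfl⟩, ?_⟩
    rwa [mechanicalHamiltonian_zero, mechanicalHamiltonian_zero]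
  · rwa [proj_image_zeroSectionOver]

theorem theorem3 (d : ℕ) (hd : 2 ≤ d)
    (M : Type*) [TopologicalSpace M] [T2Space M] [CompactSpace M] [ConnectedSpace M]
    [ChartedSpace (EuclideanSpace ℝ (Fin d)) M] [IsManifold (𝓡 d) ∞ M]
    (d' : ℕ) (s : ℝ≥0) (hs : (d' + 1 < d ∧ s ≤ 1) ∨ (d' + 1 = d ∧ s < 1)) :
    ∃ (H : LagrangianGraphs.CotangentBundle d M → ℝ)
      (Γ : (q : M) → LagrangianGraphs.CotangentSpace d q)
      (Λ : Set (LagrangianGraphs.CotangentBundle d M)),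
      LagrangianGraphs.IsCkHolder (LagrangianGraphs.cotangentModel d) d' s H ∧
      ContMDiff (LagrangianGraphs.cotangentModel d) 𝓘(ℝ, ℝ) 1 H ∧
      LagrangianGraphs.IsLagrangianGraph Γ ∧
      IsCompact Λ ∧ IsConnected Λ ∧ Λ ⊆ LagrangianGraphs.graph Γ ∧
      LagrangianGraphs.IsInvariant H Λ ∧
      (3 ≤ d → LagrangianGraphs.ContainsItsOrbits H Λ) ∧
      (∃ x ∈ Λ, ∃ y ∈ Λ, H x ≠ H y) ∧
      (∀ q, Γ q = 0) ∧
      ∃ (g : LagrangianGraphs.SmoothMetric d M) (f : M → ℝ),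
        LagrangianGraphs.IsCkHolder (𝓡 d) d' s f ∧
        LagrangianGraphs.IsWhitneyNorton d f (TotalSpace.proj '' Λ) ∧
        ∀ x, H x = LagrangianGraphs.mechanicalHamiltonian g f x := by
  obtain ⟨g⟩ := LagrangianGraphs.nonempty_smoothMetric (d := d) (M := M)
  obtain ⟨H, Γ, Λ, hH, hH1, hΓ, hΛ, hΛconn, hΛΓ, hinv, horbits, hne, hΓ0, hf⟩ :=
    theorem3_general d hd M g d' s hs
  exact ⟨H, Γ, Λ, hH, hH1, hΓ, hΛ, hΛconn, hΛΓ, hinv, horbits, hne, hΓ0, g, hf⟩
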